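/- Let $P$ be a complex polynomial of degree $d\ge 2$ with a fixed point $b=P(b)$, put $a=P'(b)$, and suppose that $d<|a|$. Let $f$ be the entire function with $f(az)=P(f(z))$ for all $z\in\mathbb C$, $f(0)=b$, $f'(0)=1$. Let $P_0^{-1},\dots,P_{d-1}^{-1}:\mathbb C\to\mathbb C$ be branches of $P^{-1}$, i.e. for every $w\in\mathbb C$ the numbers $P_0^{-1}(w),\dots,P_{d-1}^{-1}(w)$ are the solutions of $P(z)=w$ counted with multiplicity; suppose that $P_0^{-1}(b)=b$, that $P_0^{-1}$ is analytic in a neighbourhood of $b$, and that $(P_0^{-1})^{\circ n}(w)\to b$ as $n\to\infty$ for every $w\in\mathbb C$. The other branches need not be continuous. Put $Q(z)=\frac{P(z)-b}{z-b}$ (a polynomial), let $\Sigma$ be the set of all sequences $\sigma=(\sigma_n)_{n\ge1}$ in $\{0,\dots,d-1\}$ with $\sigma_n=0$ for all large $n$, let $\Sigma'=\{\sigma\in\Sigma:\sigma_1\ne0\}$, and write $P_{\sigma,n}(w)=P_{\sigma_n}^{-1}\circ\dots\circ P_{\sigma_1}^{-1}(w)$. Then $f$ has order $\frac{\ln d}{\ln|a|}<1$,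 and the following holds. (1) Let $w\in\mathbb C\setminus\{b\}$. For every $\sigma\in\Sigma$ the product $$g_\sigma(w)=(w-b)\prod_{n=1}^\infty\frac{a}{Q(P_{\sigma,n}(w))}$$ converges and is non-zero, $\sum_{\sigma\in\Sigma}|g_\sigma(w)|^{-1}<\infty$, and $$f(z)=w+(b-w)\prod_{\sigma\in\Sigma}\Bigl(1-\frac{z}{g_\sigma(w)}\Bigr),\qquad z\in\mathbb C.$$ In particular, if $b\ne0$, $$f(z)=b\prod_{\sigma\in\Sigma}\Bigl(1+\frac zb\prod_{n=1}^\infty\frac{Q(P_{\sigma,n}(0))}{a}\Bigr),\qquad z\in\mathbb C.$$ (2) For every $\sigma\in\Sigma'$ the product $$g_{\sigma,0}=a\,\bigl(P_{\sigma_1}^{-1}(b)-b\bigr)\prod_{n=2}^\infty\frac{a}{Q(P_{\sigma,n}(b))}$$ converges and is non-zero, $\sum_{m\ge0}\sum_{\sigma\in\Sigma'}|a^mg_{\sigma,0}|^{-1}<\infty$, and $$f(z)=b+z\prod_{m\ge0}\prod_{\sigma\in\Sigma'}\Bigl(1-\frac{z}{a^mg_{\sigma,0}}\Bigr)=b+\Bigl(\Bigl\{\frac{z}{g_{\sigma,0}}\Bigr\}_{\sigma\in\Sigma'};\frac1a\Bigr)_\infty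 z,\qquad z\in\mathbb C,$$ where $(\{\alpha_i\}_{i\in R};\beta)_\infty=\prod_{i\in R}\prod_{n=0}^\infty(1-\alpha_i\beta^n)$ is the $q$-Pochhammer symbol. (3) (Momenta formulas.) For every $w\in\mathbb C\setminus\{b\}$ the following products and sums converge, the sums absolutely: $$\sum_{\sigma\in\Sigma}\prod_{n=1}^\infty\frac{Q(P_{\sigma,n}(w))}{a}=1,\qquad \sum_{\sigma\in\Sigma}\prod_{n=1}^\infty\frac{Q(P_{\sigma,n}(w))^2}{a^2}=1-\frac{(b-w)P''(b)}{a^2-a},$$ and, for every $m\ge2$, $$\sum_{\sigma\in\Sigma}\prod_{n=1}^\infty\frac{Q(P_{\sigma,n}(w))^m}{a^m}=\sum_{j=1}^m\frac{(w-b)^{m-j}(j-1)!}{(m-1)!}\,B_{m,j}\bigl(f'(0),\dots,f^{(m-j+1)}(0)\bigr),$$ where $B_{m,j}(x_1,\dots,x_{m-j+1})=\sum\frac{m!}{k_1!\cdots k_{m-j+1}!}\prod_{i=1}^{m-j+1}\bigl(\frac{x_i}{i!}\bigr)^{k_i}$ is the partial Bell polynomial; the sum is over all integers $k_1,\dots,k_{m-j+1}\ge0$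 with $\sum_ik_i=j$ and $\sum_iik_i=m$. -/

import Mathlib

open Filter Topology Polynomial
open scoped Nat

namespace SchroederPoincare

noncomputable section

/-- The polynomial `Q(z) = (P(z) - b) / (z - b)`, for a fixed point `b` of `P`. -/
def Q (P : ℂ[X]) (b : ℂ) : ℂ[X] := (P - C b) /ₘ (X - C b)

/-- Sequences with values in `{0, …, d-1}` that are eventually `0`. Sequences start at index `0`
here: `σ.1 n` is the mathematical `σ_{n+1}`. -/
def Stable (d : ℕ) [NeZero d] : Type := {σ : ℕ → Fin d // ∀ᶠ n in atTop, σ n = 0}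

/-- Those eventually zero sequences whose first entry is not `0`. -/
def StableNe (d : ℕ) [NeZero d] : Type := {σ : Stable d // σ.1 0 ≠ 0}

/-- `orbit p σ w n = (p_{σ_n} ∘ ⋯ ∘ p_{σ_1}) w`, where `p j` are the branches of `P⁻¹`. -/
def orbit {d : ℕ} (p : Fin d → ℂ → ℂ) (σ : ℕ → Fin d) (w : ℂ) : ℕ → ℂ
  | 0 => w
  | n + 1 => p (σ n) (orbit p σ w n)

/-- `p 0, …, p (d-1)` are branches of `P⁻¹` on all of `ℂ`: for every `w` their values at `w` are
the solutions of `P z = w`, each listed as often as its multiplicity. -/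
def IsBranchSystem {d : ℕ} (P : ℂ[X]) (p : Fin d → ℂ → ℂ) : Prop :=
  ∀ w : ℂ, (Finset.univ : Finset (Fin d)).val.map (fun j => p j w) = (P - C w).roots

/-- `g_σ(w) = (w - b) ∏_{n ≥ 1} a / Q((p_{σ_n} ∘ ⋯ ∘ p_{σ_1}) w)`. -/
def g {d : ℕ} (P : ℂ[X]) (a b : ℂ) (p : Fin d → ℂ → ℂ) (σ : ℕ → Fin d) (w : ℂ) : ℂ :=
  (w - b) * ∏' n : ℕ, a / (Q P b).eval (orbit p σ w (n + 1))

/-- `g_{σ,0} = a (p_{σ_1} b - b) ∏_{n ≥ 2} a / Q((p_{σ_n} ∘ ⋯ ∘ p_{σ_1}) b)`. -/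
def gZero {d : ℕ} (P : ℂ[X]) (a b : ℂ) (p : Fin d → ℂ → ℂ) (σ : ℕ → Fin d) : ℂ :=
  a * (p (σ 0) b - b) * ∏' n : ℕ, a / (Q P b).eval (orbit p σ b (n + 2))

/-- The `q`-Pochhammer symbol `({α_i}; β)_∞ = ∏_i ∏_{n ≥ 0} (1 - α_i β^n)` of a family. -/
def qPochhammer {ι : Type*} (α : ι → ℂ) (β : ℂ) : ℂ :=
  ∏' i : ι, ∏' n : ℕ, (1 - α i * β ^ n)

/-- The partial Bell polynomial `B_{m,j}(x_1, …, x_{m-j+1})`, for `j ≤ m`: the sum over all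
`k_1, …, k_{m-j+1} ≥ 0` with `∑ k_i = j` and `∑ i k_i = m` (the entry `k i` is `k_{i+1}`). -/
def bell (m j : ℕ) (x : ℕ → ℂ) : ℂ :=
  ∑ k ∈ ((Finset.univ : Finset (Fin (m - j + 1))).piAntidiag j).filter
      (fun k : Fin (m - j + 1) → ℕ => ∑ i : Fin (m - j + 1), ((i : ℕ) + 1) * k i = m),
    ((m ! : ℂ) / ∏ i : Fin (m - j + 1), ((k i)! : ℂ)) *
      ∏ i : Fin (m - j + 1), (x ((i : ℕ) + 1) / (((i : ℕ) + 1)! : ℂ)) ^ k i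

/-- `M(r) = max_{|z| = r} |f z|`. -/
def maxModulus (f : ℂ → ℂ) (r : ℝ) : ℝ := sSup ((fun z => ‖f z‖) '' Metric.sphere (0 : ℂ) r)

/-- The order of growth `limsup_{r → ∞} log log M(r) / log r` of an entire function. -/
def growthOrder (f : ℂ → ℂ) : EReal :=
  limsup (fun r : ℝ => ((Real.log (Real.log (maxModulus f r)) / Real.log r : ℝ) : EReal)) atTop

end

end SchroederPoincare

/-! Near `b` the branch `p 0` is conjugate by `f` to division by `a`. A backward orbit with
eventually zero symbols converges to `b`, so it has the form `f (c / a ^ n)` from some index on, and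
applying `P` extends this down to `n = 0` (`exists_orbit_eq`). The product in `g` telescopes to the
limit of `a ^ n * (orbit n - b)`. This limit is `c` because `f' 0 = 1`, so `g` is a solution of `f c
= w` (`exists_g_eq`).

The factorization needs no Hadamard theory. Factoring `P v - w` over the branches and iterating `n`
times at `v = f (z / a ^ n)` gives an exact finite product over the `d ^ n` words of length `n`
(`prod_level`). Each factor tends to `1 - z / g`, and dominated convergence gives the infinite
product (`tprod_one_sub_div_g`). The majorant is a constant times `‖a‖⁻¹ ^ len`: it comes from a
uniform lower bound on the distance of orbits to `b` (`exists_norm_pow_len_le`), and it is summable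
because there are at most `d ^ n` words of length `n` and `d < ‖a‖`.

At `b` itself the simple factor `v - b` is split off, and the result for the other preimages of `b`
gives a recursion from `z / a` to `z` (`apply_sub_fixed`), which is iterated. The momenta formulas
are Newton's identities for the product, read off from its logarithmic derivative. The order follows
from `M (‖a‖ r) ≍ M r ^ d`. -/

namespace SchroederPoincare

/-- A Poincaré function `f` of a polynomial `P` of degree `d` at a fixed point `b` of multiplier
`a`, `d < |a|`, together with a branch system of `P⁻¹` whose branch `p 0` is analytic at `b` and
attracts every point to `b`. -/
structure IsPoincareSystem {d : ℕ} [NeZero d] (P : ℂ[X]) (a b : ℂ) (f : ℂ → ℂ)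
    (p : Fin d → ℂ → ℂ) : Prop where
  two_le : 2 ≤ d
  natDegree_eq : P.natDegree = d
  eval_fixed : P.eval b = b
  multiplier_eq : a = P.derivative.eval b
  lt_norm : (d : ℝ) < ‖a‖
  differentiable : Differentiable ℂ f
  map_mul : ∀ z, f (a * z) = P.eval (f z)
  map_zero : f 0 = b
  deriv_zero : deriv f 0 = 1
  isBranchSystem : IsBranchSystem P p
  branch_fixed : p 0 b = b
  analyticAt_branch : AnalyticAt ℂ (p 0) b
  tendsto_iterate : ∀ w, Tendsto (fun n : ℕ => (p 0)^[n] w) atTop (𝓝 b)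

/-! ### The quotient `Q` and the local conjugation at the fixed point -/

theorem eval_Q_mul {P : ℂ[X]} {b : ℂ} (h : P.eval b = b) (v : ℂ) :
    (Q P b).eval v * (v - b) = P.eval v - b := by
  have h1 : (X - C b) * Q P b = P - C b :=
    mul_divByMonic_eq_iff_isRoot.2 (by simp [IsRoot, h])
  have h2 := congrArg (eval v) h1
  simp only [eval_mul, eval_sub, eval_X, eval_C] at h2
  rw [← h2, mul_comm]

theorem eval_Q_self {P : ℂ[X]} {b : ℂ} (h : P.eval b = b) :
    (Q P b).eval b = P.derivative.eval b := by
  have h1 : (X - C b) * Q P b = P - C b :=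
    mul_divByMonic_eq_iff_isRoot.2 (by simp [IsRoot, h])
  have h2 := congrArg (fun q : ℂ[X] => eval b (derivative q)) h1
  simpa [derivative_mul] using h2

namespace IsPoincareSystem

variable {d : ℕ} [NeZero d] {P : ℂ[X]} {a b : ℂ} {f : ℂ → ℂ} {p : Fin d → ℂ → ℂ}
  (S : IsPoincareSystem P a b f p)
include S

theorem one_lt_norm : 1 < ‖a‖ := by
  have h1 : (2 : ℝ) ≤ d := by exact_mod_cast S.two_le
  linarith [S.lt_norm]

theorem norm_pos : 0 < ‖a‖ := one_pos.trans S.one_lt_norm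

theorem ne_zero : a ≠ 0 := norm_pos_iff.1 S.norm_pos

theorem sub_C_ne_zero (w : ℂ) : P - C w ≠ 0 := by
  intro h
  have h1 : P.natDegree = 0 := by rw [sub_eq_zero.1 h, natDegree_C]
  have := S.natDegree_eq
  have := S.two_le
  omega

theorem eval_branch (j : Fin d) (w : ℂ) : P.eval (p j w) = w := by
  have h : p j w ∈ (P - C w).roots := by
    rw [← S.isBranchSystem w]
    exact Multiset.mem_map_of_mem _ (Finset.mem_univ j)
  have h1 := (mem_roots (S.sub_C_ne_zero w)).1 h
  simpa [IsRoot, sub_eq_zero] using h1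

theorem branch_ne_fixed {w : ℂ} (hw : w ≠ b) (j : Fin d) : p j w ≠ b := fun h =>
  hw (by rw [← S.eval_branch j w, h, S.eval_fixed])

/-- A point is the value of two branches only if it is critical. -/
theorem branch_injective {i j : Fin d} {w : ℂ} (h : p i w = p j w)
    (hd : P.derivative.eval (p i w) ≠ 0) : i = j := by
  classical
  by_contra hij
  have h2 : 1 < (P - C w).rootMultiplicity (p i w) := by
    rw [← count_roots, ← S.isBranchSystem w, Multiset.count_map]
    have : ({i, j} : Finset (Fin d)).card ≤
        (Finset.univ.filter (fun k => p i w = p k w)).card := by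
      apply Finset.card_le_card
      intro k hk
      rcases Finset.mem_insert.1 hk with rfl | hk
      · simp
      · rw [Finset.mem_singleton.1 hk]; simp [h]
    rw [Finset.card_pair hij] at this
    exact this
  have h3 := ((one_lt_rootMultiplicity_iff_isRoot (S.sub_C_ne_zero w)).1 h2).2
  exact hd (by simpa [IsRoot] using h3)

theorem hasStrictDerivAt_zero : HasStrictDerivAt f 1 0 := by
  have h := (S.differentiable.analyticAt 0).hasStrictDerivAt
  rwa [S.deriv_zero] at h

theorem map_div (z : ℂ) : P.eval (f (z / a)) = f z := by
  rw [← S.map_mul, mul_div_cancel₀ z S.ne_zero]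

theorem tendsto_apply_zero : Tendsto f (𝓝 0) (𝓝 b) := by
  have h := S.differentiable.continuous.tendsto 0
  rwa [S.map_zero] at h

/-- Both sides are close to `b` and have the same image under `P`, which is injective near `b` since
`P' b = a ≠ 0`. -/
theorem eventually_branch_zero : ∀ᶠ ζ in 𝓝 (0 : ℂ), p 0 (f ζ) = f (ζ / a) := by
  have hP : HasStrictDerivAt (fun x => P.eval x) a b := by
    have h := P.hasStrictDerivAt b
    rwa [← S.multiplier_eq] at h
  have hinj := hP.hasStrictFDerivAt_equiv S.ne_zero |>.eventually_left_inverse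
  have h1 : Tendsto (fun ζ => p 0 (f ζ)) (𝓝 0) (𝓝 b) := by
    have h := S.analyticAt_branch.continuousAt.tendsto
    rw [S.branch_fixed] at h
    exact h.comp S.tendsto_apply_zero
  have h2 : Tendsto (fun ζ => f (ζ / a)) (𝓝 0) (𝓝 b) := by
    refine S.tendsto_apply_zero.comp ?_
    have : Continuous fun ζ : ℂ => ζ / a := by fun_prop
    simpa using this.tendsto 0
  filter_upwards [h1.eventually hinj, h2.eventually hinj] with ζ e1 e2
  rw [← e1, ← e2, S.eval_branch, S.map_div]

/-- For the last clause, applying `P` to `p j u = f ζ` gives `u = f (a * ζ)`, so the local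
conjugation yields `p 0 u = f ζ` as well. As `f ζ` is not critical, it is listed only once among the
values at `u`. -/
theorem exists_radius : ∃ R > 0, ∀ ζ : ℂ, ‖ζ‖ < R →
    p 0 (f ζ) = f (ζ / a) ∧ ‖ζ‖ / 2 ≤ ‖f ζ - b‖ ∧ ‖f ζ - b‖ ≤ 2 * ‖ζ‖ ∧
      ∀ j u, p j u = f ζ → j = 0 := by
  have e1 := S.eventually_branch_zero
  have e2 : ∀ᶠ ζ in 𝓝 (0 : ℂ), p 0 (f (a * ζ)) = f (a * ζ / a) := by
    have : Tendsto (fun ζ : ℂ => a * ζ) (𝓝 0) (𝓝 0) := by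
      have : Continuous fun ζ : ℂ => a * ζ := by fun_prop
      simpa using this.tendsto 0
    exact this.eventually e1
  have e3 : ∀ᶠ ζ in 𝓝 (0 : ℂ), P.derivative.eval (f ζ) ≠ 0 := by
    have h : Tendsto (fun ζ => P.derivative.eval (f ζ)) (𝓝 0) (𝓝 a) := by
      rw [S.multiplier_eq]
      exact (P.derivative.continuous.tendsto b).comp S.tendsto_apply_zero
    exact h.eventually_ne S.ne_zero
  have e4 : ∀ᶠ ζ in 𝓝 (0 : ℂ), ‖f ζ - b - ζ‖ ≤ 1 / 2 * ‖ζ‖ := by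
    have h := S.hasStrictDerivAt_zero.hasDerivAt.isLittleO.def (c := 1 / 2) (by norm_num)
    simpa [S.map_zero] using h
  obtain ⟨R, hR, h⟩ := Metric.eventually_nhds_iff.1 (e1.and (e2.and (e3.and e4)))
  refine ⟨R, hR, fun ζ hζ => ?_⟩
  obtain ⟨h1, h2, h3, h4⟩ := h (by simpa using hζ)
  refine ⟨h1, ?_, ?_, fun j u hj => ?_⟩
  · have := norm_sub_norm_le ζ (f ζ - b)
    rw [norm_sub_rev ζ] at this
    linarith
  · have := norm_sub_norm_le (f ζ - b) ζ
    linarith [norm_nonneg ζ]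
  · have hu : f (a * ζ) = u := by rw [S.map_mul, ← hj, S.eval_branch]
    rw [hu, mul_div_cancel_left₀ ζ S.ne_zero, ← hj] at h2
    exact (S.branch_injective h2 (by rwa [h2, hj])).symm

theorem image_ball_mem_nhds {r : ℝ} (hr : 0 < r) : f '' Metric.ball 0 r ∈ 𝓝 b := by
  rw [← S.map_zero, ← S.hasStrictDerivAt_zero.map_nhds_eq one_ne_zero]
  exact image_mem_map (Metric.ball_mem_nhds 0 hr)

/-! ### Backward orbits and the numbers `g` -/

theorem eval_orbit_succ (σ : ℕ → Fin d) (w : ℂ) (n : ℕ) :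
    P.eval (orbit p σ w (n + 1)) = orbit p σ w n := S.eval_branch _ _

theorem orbit_ne_fixed {w : ℂ} (hw : w ≠ b) (σ : ℕ → Fin d) (n : ℕ) : orbit p σ w n ≠ b := by
  induction n with
  | zero => exact hw
  | succ n ih => exact S.branch_ne_fixed ih _

theorem exists_orbit_eq (σ : Stable d) (w : ℂ) :
    ∃ c : ℂ, ∀ n, orbit p σ.1 w n = f (c / a ^ n) := by
  have ha := S.ne_zero
  obtain ⟨R, hR, hloc⟩ := S.exists_radius
  obtain ⟨M, hM⟩ := eventually_atTop.1 σ.2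
  have horb : ∀ k, orbit p σ.1 w (M + k) = (p 0)^[k] (orbit p σ.1 w M) := by
    intro k
    induction k with
    | zero => rfl
    | succ k ih =>
      rw [Function.iterate_succ_apply', ← ih, ← add_assoc]
      change p (σ.1 (M + k)) _ = _
      rw [hM _ (by omega)]
  obtain ⟨k, ζ, hζ, hk⟩ := ((S.tendsto_iterate (orbit p σ.1 w M)).eventually
    (S.image_ball_mem_nhds hR)).exists
  rw [← horb] at hk
  rw [mem_ball_zero_iff] at hζ
  have hdiv : ∀ i, ‖ζ / a ^ i‖ < R := fun i => by
    rw [norm_div, norm_pow]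
    exact (div_le_self (norm_nonneg _) (one_le_pow₀ S.one_lt_norm.le)).trans_lt hζ
  set N := M + k with hN
  have hup : ∀ i, orbit p σ.1 w (N + i) = f (ζ / a ^ i) := by
    intro i
    induction i with
    | zero => simp [hk]
    | succ i ih =>
      change p (σ.1 (N + i)) (orbit p σ.1 w (N + i)) = _
      rw [hM _ (by omega), ih, (hloc _ (hdiv i)).1, pow_succ, div_div]
  -- The constant is chosen so that `c / a ^ N = ζ`. Indices above `N` follow the local conjugation;
  -- those below are reached by applying `P`.
  refine ⟨ζ * a ^ N, fun n => ?_⟩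
  rcases le_total N n with h | h
  · obtain ⟨i, rfl⟩ := Nat.exists_eq_add_of_le h
    rw [hup, pow_add a N i, mul_comm (a ^ N), mul_div_mul_right _ _ (pow_ne_zero N ha)]
  · refine Nat.decreasingInduction' (m := n) (n := N)
      (P := fun n => orbit p σ.1 w n = f (ζ * a ^ N / a ^ n)) (fun i _ _ ih => ?_) h ?_
    · rw [← S.eval_orbit_succ, ih, ← S.map_div (ζ * a ^ N / a ^ i), pow_succ, div_div]
    · rw [← hk]
      congr 1
      field_simp

theorem tendsto_rescale (z : ℂ) :
    Tendsto (fun n : ℕ => a ^ n * (f (z / a ^ n) - b)) atTop (𝓝 z) := by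
  have ha := S.ne_zero
  rcases eq_or_ne z 0 with rfl | hz
  · simp [S.map_zero]
  have h := S.hasStrictDerivAt_zero.hasDerivAt.tendsto_slope
  have h1 : Tendsto (fun n : ℕ => z / a ^ n) atTop (𝓝[≠] 0) := by
    refine tendsto_nhdsWithin_iff.2 ⟨?_, .of_forall fun n => by simp [hz, ha]⟩
    have h2 : ‖a⁻¹‖ < 1 := by rw [norm_inv]; exact inv_lt_one_of_one_lt₀ S.one_lt_norm
    have h3 := (tendsto_pow_atTop_nhds_zero_of_norm_lt_one h2).const_mul z
    simpa [div_eq_mul_inv] using h3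
  have h4 := (h.comp h1).const_mul z
  rw [mul_one] at h4
  refine h4.congr fun n => ?_
  simp only [Function.comp_apply, slope_def_field, sub_zero, S.map_zero]
  field_simp

/-- Telescoping: each factor `Q` is the quotient of the distances to `b`, with sign, of two
consecutive orbit points. -/
theorem prod_Q_div {w : ℂ} (hw : w ≠ b) (σ : ℕ → Fin d) (n : ℕ) :
    ∏ k ∈ Finset.range n, (Q P b).eval (orbit p σ w (k + 1)) / a =
      (w - b) / (a ^ n * (orbit p σ w n - b)) := by
  have ha := S.ne_zero
  induction n with
  | zero =>
    have : w - b ≠ 0 := sub_ne_zero.2 hw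
    simp [orbit, this]
  | succ n ih =>
    have h1 : orbit p σ w n - b ≠ 0 := sub_ne_zero.2 (S.orbit_ne_fixed hw σ n)
    have h2 : orbit p σ w (n + 1) - b ≠ 0 := sub_ne_zero.2 (S.orbit_ne_fixed hw σ (n + 1))
    have h3 := eval_Q_mul S.eval_fixed (orbit p σ w (n + 1))
    rw [S.eval_orbit_succ] at h3
    rw [Finset.prod_range_succ, ih, eq_div_of_mul_eq h2 h3, pow_succ]
    field_simp

/-- Infinite products along a geometric sequence tending to `0`. -/
theorem multipliable_geometric {h : ℂ → ℂ} (hd : DifferentiableAt ℂ h 0) (h0 : h 0 = 1) (c : ℂ) :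
    Multipliable fun n : ℕ => h (c / a ^ (n + 1)) := by
  have h2 : ‖a⁻¹‖ < 1 := by rw [norm_inv]; exact inv_lt_one_of_one_lt₀ S.one_lt_norm
  have hs : Summable fun n : ℕ => ‖c / a ^ (n + 1)‖ := by
    have := ((summable_geometric_of_lt_one (norm_nonneg _) h2).mul_left ‖c‖)
    rw [← summable_nat_add_iff 1] at this
    refine this.congr fun n => ?_
    rw [norm_div, norm_pow, norm_inv, inv_pow, div_eq_mul_inv]
  have ht : Tendsto (fun n : ℕ => c / a ^ (n + 1)) atTop (𝓝 0) :=
    tendsto_zero_iff_norm_tendsto_zero.2 hs.tendsto_atTop_zero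
  have hO := hd.isBigO_sub.comp_tendsto ht
  have hsum : Summable fun n : ℕ => ‖h (c / a ^ (n + 1)) - 1‖ := by
    refine summable_of_isBigO_nat hs (Asymptotics.IsBigO.norm_norm ?_)
    simpa [Function.comp_def, h0] using hO
  refine (multipliable_one_add_of_summable hsum).congr fun n => by ring

theorem multipliable_Q_div (σ : Stable d) (w : ℂ) :
    Multipliable fun n : ℕ => (Q P b).eval (orbit p σ.1 w (n + 1)) / a := by
  obtain ⟨c, hc⟩ := S.exists_orbit_eq σ w
  have h := S.multipliable_geometric (h := fun ζ => (Q P b).eval (f ζ) / a)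
    (((Q P b).differentiable.comp S.differentiable).differentiableAt.div_const a)
    (by simp only [S.map_zero, eval_Q_self S.eval_fixed, ← S.multiplier_eq, div_self S.ne_zero]) c
  simpa only [← hc] using h

theorem multipliable_div_Q (σ : Stable d) (w : ℂ) :
    Multipliable fun n : ℕ => a / (Q P b).eval (orbit p σ.1 w (n + 1)) := by
  have h0 : (Q P b).eval (f 0) = a := by
    rw [S.map_zero, eval_Q_self S.eval_fixed, ← S.multiplier_eq]
  obtain ⟨c, hc⟩ := S.exists_orbit_eq σ w
  have h := S.multipliable_geometric (h := fun ζ => a / (Q P b).eval (f ζ))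
    ((differentiableAt_const a).div
      ((Q P b).differentiable.comp S.differentiable).differentiableAt
      (by simpa [h0] using S.ne_zero))
    (by simp only [h0, div_self S.ne_zero]) c
  simpa only [← hc] using h

theorem exists_g_eq {w : ℂ} (hw : w ≠ b) (σ : Stable d) :
    g P a b p σ.1 w ≠ 0 ∧ ∀ n, orbit p σ.1 w n = f (g P a b p σ.1 w / a ^ n) := by
  have ha := S.ne_zero
  have hwb : w - b ≠ 0 := sub_ne_zero.2 hw
  obtain ⟨c, hc⟩ := S.exists_orbit_eq σ w
  have hc0 : c ≠ 0 := by
    rintro rfl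
    exact hw (by simpa [orbit, S.map_zero] using hc 0)
  have h1 := (S.multipliable_div_Q σ w).hasProd.tendsto_prod_nat
  -- By telescoping, these are the partial products of `a / Q`, so the infinite product equals `c /
  -- (w - b)`.
  have h2 : Tendsto (fun n : ℕ => a ^ n * (f (c / a ^ n) - b) / (w - b)) atTop
      (𝓝 (c / (w - b))) := (S.tendsto_rescale c).div_const _
  have h3 := tendsto_nhds_unique h1 (h2.congr fun n => ?_)
  · have hg : g P a b p σ.1 w = c := by
      rw [g, h3]
      field_simp
    rw [hg]
    exact ⟨hc0, hc⟩
  · rw [← hc, ← inv_inj, ← Finset.prod_inv_distrib]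
    simp only [inv_div]
    exact (S.prod_Q_div hw σ.1 n).symm

theorem g_ne_zero {w : ℂ} (hw : w ≠ b) (σ : Stable d) : g P a b p σ.1 w ≠ 0 :=
  (S.exists_g_eq hw σ).1

theorem tendsto_g {w : ℂ} (hw : w ≠ b) (σ : Stable d) :
    Tendsto (fun n : ℕ => a ^ n * (orbit p σ.1 w n - b)) atTop (𝓝 (g P a b p σ.1 w)) := by
  simp only [(S.exists_g_eq hw σ).2]
  exact S.tendsto_rescale _

theorem tprod_Q_div {w : ℂ} (hw : w ≠ b) (σ : Stable d) :
    ∏' n : ℕ, (Q P b).eval (orbit p σ.1 w (n + 1)) / a = (w - b) / g P a b p σ.1 w := by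
  have h1 := (S.multipliable_Q_div σ w).hasProd.tendsto_prod_nat
  refine tendsto_nhds_unique h1 ?_
  simp only [S.prod_Q_div hw]
  exact tendsto_const_nhds.div (S.tendsto_g hw σ) (S.g_ne_zero hw σ)

theorem hasProd_Q_pow_div {w : ℂ} (hw : w ≠ b) (σ : Stable d) (m : ℕ) :
    HasProd (fun n : ℕ => (Q P b).eval (orbit p σ.1 w (n + 1)) ^ m / a ^ m)
      (((w - b) / g P a b p σ.1 w) ^ m) := by
  have h := (S.multipliable_Q_div σ w).hasProd.pow m
  rw [S.tprod_Q_div hw] at h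
  simpa only [div_pow] using h

end IsPoincareSystem

/-! ### Counting eventually zero sequences -/

namespace Stable

variable {d : ℕ} [NeZero d]

/-- Prepending an entry to an eventually zero sequence. -/
def consEquiv (d : ℕ) [NeZero d] : Fin d × Stable d ≃ Stable d where
  toFun x := ⟨fun n => Nat.casesOn n x.1 x.2.1, by
    obtain ⟨M, hM⟩ := eventually_atTop.1 x.2.2
    refine eventually_atTop.2 ⟨M + 1, fun n hn => ?_⟩
    obtain ⟨k, rfl⟩ := Nat.exists_eq_add_of_le' hn
    exact hM (k + M) (by omega)⟩
  invFun σ := (σ.1 0, ⟨fun n => σ.1 (n + 1), (tendsto_add_atTop_nat 1).eventually σ.2⟩)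
  left_inv _ := rfl
  right_inv σ := Subtype.ext (_root_.funext fun n => by cases n <;> rfl)

theorem orbit_consEquiv (p : Fin d → ℂ → ℂ) (x : Fin d × Stable d) (w : ℂ) (n : ℕ) :
    orbit p (consEquiv d x).1 w (n + 1) = orbit p x.2.1 (p x.1 w) n := by
  induction n with
  | zero => rfl
  | succ n ih =>
    rw [orbit, ih]
    rfl

/-- The zero sequence. -/
def zeroSeq (d : ℕ) [NeZero d] : Stable d := ⟨fun _ => 0, .of_forall fun _ => rfl⟩

/-- The sequences that vanish from the index `n` on. -/
def level (d : ℕ) [NeZero d] : ℕ → Finset (Stable d)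
  | 0 => {zeroSeq d}
  | n + 1 => (Finset.univ ×ˢ level d n).map (consEquiv d).toEmbedding

theorem mem_level {n : ℕ} {σ : Stable d} : σ ∈ level d n ↔ ∀ k, n ≤ k → σ.1 k = 0 := by
  induction n generalizing σ with
  | zero =>
    simp only [level, Finset.mem_singleton, zero_le, forall_const]
    exact ⟨fun h k => by rw [h]; rfl, fun h => Subtype.ext (_root_.funext h)⟩
  | succ n ih =>
    obtain ⟨x, rfl⟩ := (consEquiv d).surjective σ
    simp only [level, Finset.mem_map_equiv, Equiv.symm_apply_apply, Finset.mem_product,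
      Finset.mem_univ, true_and, ih]
    refine ⟨fun h k hk => ?_, fun h k hk => h (k + 1) (by omega)⟩
    obtain ⟨k, rfl⟩ := Nat.exists_eq_add_of_le' hk
    exact h (k + n) (by omega)

theorem card_level (n : ℕ) : (level d n).card = d ^ n := by
  induction n with
  | zero => simp [level]
  | succ n ih => simp [level, ih, pow_succ, mul_comm]

open Classical in
/-- The least index from which on a sequence vanishes. -/
noncomputable def len (σ : Stable d) : ℕ := Nat.find (eventually_atTop.1 σ.2)

theorem eq_zero_of_len_le (σ : Stable d) {k : ℕ} (h : σ.len ≤ k) : σ.1 k = 0 := by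
  classical
  exact Nat.find_spec (eventually_atTop.1 σ.2) k h

theorem len_le_iff (σ : Stable d) (n : ℕ) : σ.len ≤ n ↔ σ ∈ level d n := by
  classical
  rw [mem_level]
  exact ⟨fun h k hk => σ.eq_zero_of_len_le (h.trans hk), fun h => Nat.find_min' _ h⟩

theorem ne_zero_of_len_eq_succ (σ : Stable d) {m : ℕ} (h : σ.len = m + 1) : σ.1 m ≠ 0 := by
  intro h0
  have h1 : σ.len ≤ m := (σ.len_le_iff m).2 <| mem_level.2 fun k hk => by
    rcases hk.eq_or_lt with rfl | hk
    · exact h0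
    · exact σ.eq_zero_of_len_le (by omega)
  omega

/-- At most `d ^ n` sequences have length `n`, so a geometric series of ratio `d * ρ` dominates. -/
theorem summable_pow_len {ρ : ℝ} (h0 : 0 ≤ ρ) (h1 : d * ρ < 1) :
    Summable fun σ : Stable d => ρ ^ σ.len := by
  classical
  have hs : Summable fun n : ℕ => (d * ρ) ^ n := summable_geometric_of_lt_one (by positivity) h1
  refine summable_of_sum_le (fun σ => by positivity) (c := ∑' n : ℕ, (d * ρ) ^ n) fun s => ?_
  rw [← Finset.sum_fiberwise_of_maps_to (t := s.image len)
    (fun σ hσ => Finset.mem_image_of_mem _ hσ)]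
  refine (Finset.sum_le_sum fun n _ => ?_).trans
    (hs.sum_le_tsum (s.image len) fun n _ => by positivity)
  calc ∑ σ ∈ s with σ.len = n, ρ ^ σ.len = ∑ σ ∈ s with σ.len = n, ρ ^ n :=
        Finset.sum_congr rfl fun σ hσ => by rw [(Finset.mem_filter.1 hσ).2]
    _ = (s.filter fun σ => σ.len = n).card * ρ ^ n := by rw [Finset.sum_const, nsmul_eq_mul]
    _ ≤ (level d n).card * ρ ^ n := by
        gcongr
        intro σ hσ
        exact (σ.len_le_iff n).1 (Finset.mem_filter.1 hσ).2.le
    _ = (d * ρ) ^ n := by rw [card_level, mul_pow, Nat.cast_pow]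

end Stable

/-! ### The factorization for `w ≠ b` -/

namespace IsPoincareSystem

variable {d : ℕ} [NeZero d] {P : ℂ[X]} {a b : ℂ} {f : ℂ → ℂ} {p : Fin d → ℂ → ℂ}
  (S : IsPoincareSystem P a b f p)
include S

/-- Orbits do not approach `b` faster than geometrically, counted from the last nonzero entry. -/
theorem exists_norm_pow_len_le {w : ℂ} (hw : w ≠ b) :
    ∃ K : ℝ, 0 < K ∧ ∀ (σ : Stable d) (n : ℕ), σ.len ≤ n →
      ‖a‖ ^ σ.len ≤ K * (‖a‖ ^ n * ‖orbit p σ.1 w n - b‖) := by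
  obtain ⟨R, hR, hloc⟩ := S.exists_radius
  have hwb : 0 < ‖w - b‖ := norm_pos_iff.2 (sub_ne_zero.2 hw)
  -- The bound `2 * r ≤ ‖w - b‖` keeps `w` itself outside `f '' ball 0 r`, which settles sequences
  -- of length `0`.
  obtain ⟨r, hr, hrR, hrw⟩ : ∃ r > 0, r ≤ R ∧ 2 * r ≤ ‖w - b‖ :=
    ⟨min R (‖w - b‖ / 2), by positivity, min_le_left _ _, by linarith [min_le_right R (‖w - b‖ / 2)]⟩
  -- At time `len` the orbit is outside `f '' ball 0 r`, because the last symbol is nonzero. When it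
  -- first enters, as `f ζ`, the previous point `f (a * ζ)` was outside, so `r ≤ ‖a * ζ‖`. From then
  -- on each step divides `ζ` by `a`, and `‖a‖ ^ n * ‖ζ‖` is constant.
  have key : ∀ (σ : Stable d) (n : ℕ), σ.len ≤ n → orbit p σ.1 w n ∉ f '' Metric.ball 0 r ∨
      ∃ ζ : ℂ, ‖ζ‖ < r ∧ f ζ = orbit p σ.1 w n ∧ ‖a‖ ^ σ.len * r ≤ ‖a‖ ^ n * ‖ζ‖ := by
    intro σ n hn
    induction n, hn using Nat.le_induction with
    | base =>
      left
      rintro ⟨ζ, hζ, h⟩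
      rw [mem_ball_zero_iff] at hζ
      obtain ⟨-, -, h2, h3⟩ := hloc ζ (hζ.trans_le hrR)
      rcases hm : σ.len with _ | m
      · rw [hm] at h
        rw [h] at h2
        have : ‖w - b‖ ≤ 2 * ‖ζ‖ := h2
        linarith
      · rw [hm] at h
        exact σ.ne_zero_of_len_eq_succ hm (h3 _ _ h.symm)
    | succ n hn ih =>
      have horb : orbit p σ.1 w (n + 1) = p 0 (orbit p σ.1 w n) := by
        rw [orbit, σ.eq_zero_of_len_le hn]
      rcases ih with h | ⟨ζ, hζ, h, hle⟩
      · by_cases hmem : orbit p σ.1 w (n + 1) ∈ f '' Metric.ball 0 r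
        · obtain ⟨ζ, hζ, h'⟩ := hmem
          refine .inr ⟨ζ, by simpa using hζ, h', ?_⟩
          have h1 : r ≤ ‖a * ζ‖ := by
            by_contra! hlt
            refine h ⟨a * ζ, by simpa using hlt, ?_⟩
            rw [S.map_mul, h', S.eval_orbit_succ]
          rw [norm_mul] at h1
          rw [pow_succ, mul_assoc]
          exact mul_le_mul (pow_le_pow_right₀ S.one_lt_norm.le hn) h1 hr.le (by positivity)
        · exact .inl hmem
      · refine .inr ⟨ζ / a, ?_, ?_, ?_⟩
        · rw [norm_div]
          exact (div_le_self (norm_nonneg _) S.one_lt_norm.le).trans_lt hζ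
        · rw [horb, ← h, (hloc ζ (hζ.trans_le hrR)).1]
        · rw [norm_div, pow_succ, mul_assoc, mul_div_cancel₀ _ S.norm_pos.ne']
          exact hle
  obtain ⟨δ, hδ, hball⟩ := Metric.mem_nhds_iff.1 (S.image_ball_mem_nhds hr)
  -- The first summand serves orbit points outside the image of the ball, at distance at least `δ`
  -- from `b`; the second serves those inside.
  refine ⟨1 / δ + 2 / r, by positivity, fun σ n hn => ?_⟩
  have hN := S.norm_pos
  rw [add_mul]
  rcases key σ n hn with h | ⟨ζ, hζ, h, hle⟩
  · have h1 : δ ≤ ‖orbit p σ.1 w n - b‖ := by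
      by_contra! hlt
      exact h (hball (by rwa [mem_ball_iff_norm]))
    have h2 : ‖a‖ ^ σ.len * δ ≤ ‖a‖ ^ n * ‖orbit p σ.1 w n - b‖ :=
      mul_le_mul (pow_le_pow_right₀ S.one_lt_norm.le hn) h1 hδ.le (by positivity)
    have h3 : ‖a‖ ^ σ.len ≤ 1 / δ * (‖a‖ ^ n * ‖orbit p σ.1 w n - b‖) := by
      rw [one_div, inv_mul_eq_div, le_div_iff₀ hδ]; exact h2
    exact h3.trans (le_add_of_nonneg_right (by positivity))
  · have h1 := (hloc ζ (hζ.trans_le hrR)).2.1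
    rw [h] at h1
    have h2 : ‖a‖ ^ σ.len * r ≤ 2 * (‖a‖ ^ n * ‖orbit p σ.1 w n - b‖) := by
      refine hle.trans ?_
      rw [mul_left_comm]
      gcongr
      linarith
    have h3 : ‖a‖ ^ σ.len ≤ 2 / r * (‖a‖ ^ n * ‖orbit p σ.1 w n - b‖) := by
      rw [div_mul_eq_mul_div, le_div_iff₀ hr]; exact h2
    exact h3.trans (le_add_of_nonneg_left (by positivity))

theorem summable_inv_pow_len : Summable fun σ : Stable d => (‖a‖⁻¹) ^ σ.len := by
  refine Stable.summable_pow_len (by positivity) ?_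
  rw [← div_eq_mul_inv, div_lt_one S.norm_pos]
  exact S.lt_norm

theorem summable_norm_inv_g {w : ℂ} (hw : w ≠ b) :
    Summable fun σ : Stable d => ‖(g P a b p σ.1 w)⁻¹‖ := by
  obtain ⟨K, hK, h⟩ := S.exists_norm_pow_len_le hw
  refine (S.summable_inv_pow_len.mul_left K).of_nonneg_of_le (fun _ => norm_nonneg _) fun σ => ?_
  have h1 : ‖a‖ ^ σ.len ≤ K * ‖g P a b p σ.1 w‖ := by
    refine ge_of_tendsto ((S.tendsto_g hw σ).norm.const_mul K) ?_
    filter_upwards [eventually_ge_atTop σ.len] with n hn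
    rw [norm_mul, norm_pow]
    exact h σ n hn
  have h2 : 0 < ‖g P a b p σ.1 w‖ := norm_pos_iff.2 (S.g_ne_zero hw σ)
  have h3 : 0 < ‖a‖ ^ σ.len := pow_pos S.norm_pos _
  rw [norm_inv, inv_pow, ← div_eq_mul_inv, le_div_iff₀ h3, inv_mul_le_iff₀ h2, mul_comm]
  exact h1

theorem summable_norm_div_g {w : ℂ} (hw : w ≠ b) (z : ℂ) :
    Summable fun σ : Stable d => ‖-(z / g P a b p σ.1 w)‖ := by
  refine ((S.summable_norm_inv_g hw).mul_left ‖z‖).congr fun σ => ?_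
  rw [norm_neg, div_eq_mul_inv, norm_mul]

theorem multipliable_one_sub_div_g {w : ℂ} (hw : w ≠ b) (z : ℂ) :
    Multipliable fun σ : Stable d => 1 - z / g P a b p σ.1 w := by
  simpa only [sub_eq_add_neg] using multipliable_one_add_of_summable (S.summable_norm_div_g hw z)

theorem eval_sub_eq_prod (w v : ℂ) :
    P.eval v - w = P.leadingCoeff * ∏ j, (v - p j w) := by
  have h1 := C_leadingCoeff_mul_prod_multiset_X_sub_C
    (p := P - C w) (by rw [← S.isBranchSystem w, natDegree_sub_C, S.natDegree_eq]; simp)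
  have h2 : (P - C w).leadingCoeff = P.leadingCoeff :=
    leadingCoeff_sub_of_degree_lt <| by
      refine degree_C_le.trans_lt ?_
      rw [← natDegree_pos_iff_degree_pos, S.natDegree_eq]
      have := S.two_le
      omega
  rw [← S.isBranchSystem w, Multiset.map_map, h2] at h1
  have h3 := congrArg (eval v) h1
  simp only [eval_mul, eval_C, eval_sub] at h3
  rw [← h3]
  congr 1
  rw [eval_multiset_prod, Multiset.map_map, Finset.prod]
  simp

theorem sub_div_eq_prod {w : ℂ} (hw : w ≠ b) (v : ℂ) :
    (P.eval v - w) / (b - w) = ∏ j, (v - p j w) / (b - p j w) := by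
  have h := S.eval_sub_eq_prod w b
  rw [S.eval_fixed] at h
  have h1 : P.leadingCoeff ≠ 0 := by
    intro h0
    rw [h0, zero_mul] at h
    exact hw (sub_eq_zero.1 h).symm
  rw [S.eval_sub_eq_prod, h, mul_div_mul_left _ _ h1, Finset.prod_div_distrib]

/-- Induction on the word length: the first symbol runs over the factors of `(P v - w) / (b - w)`
with `v = f (z / a)`, and the remaining word starts at `p j w`. -/
theorem prod_level {w : ℂ} (hw : w ≠ b) (n : ℕ) (z : ℂ) :
    ∏ σ ∈ Stable.level d n, (1 - (f (z / a ^ n) - b) / (orbit p σ.1 w n - b)) =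
      (f z - w) / (b - w) := by
  induction n generalizing w z with
  | zero =>
    have : w - b ≠ 0 := sub_ne_zero.2 hw
    have : b - w ≠ 0 := sub_ne_zero.2 hw.symm
    simp only [Stable.level, Finset.prod_singleton, pow_zero, div_one, orbit]
    field_simp
    ring
  | succ n ih =>
    rw [Stable.level, Finset.prod_map, Finset.prod_product, ← S.map_div z, S.sub_div_eq_prod hw]
    refine Finset.prod_congr rfl fun j _ => ?_
    rw [← ih (S.branch_ne_fixed hw j)]
    refine Finset.prod_congr rfl fun σ _ => ?_
    rw [Equiv.coe_toEmbedding, Stable.orbit_consEquiv, pow_succ', div_div]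

theorem tprod_one_sub_div_g {w : ℂ} (hw : w ≠ b) (z : ℂ) :
    ∏' σ : Stable d, (1 - z / g P a b p σ.1 w) = (f z - w) / (b - w) := by
  classical
  have ha := S.ne_zero
  obtain ⟨K, hK, hbd⟩ := S.exists_norm_pow_len_le hw
  obtain ⟨C, hC⟩ := (S.tendsto_rescale z).norm.bddAbove_range
  have hC' : ∀ n : ℕ, ‖a‖ ^ n * ‖f (z / a ^ n) - b‖ ≤ C := fun n => by
    rw [← norm_pow, ← norm_mul]; exact hC ⟨n, rfl⟩
  have hC0 : 0 ≤ C := le_trans (by positivity) (hC' 0)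
  -- Extension by `0` beyond level `n` turns the finite products into products over one index set,
  -- all with the same value.
  let F : ℕ → Stable d → ℂ := fun n σ =>
    if σ ∈ Stable.level d n then -((f (z / a ^ n) - b) / (orbit p σ.1 w n - b)) else 0
  have h1 : ∀ n, ∏' σ, (1 + F n σ) = (f z - w) / (b - w) := fun n => by
    rw [← S.prod_level hw n z, tprod_eq_prod (s := Stable.level d n)]
    · exact Finset.prod_congr rfl fun σ hσ => by simp [F, hσ, sub_eq_add_neg]
    · intro σ hσ
      simp [F, hσ]
  have h2 : ∀ σ, Tendsto (F · σ) atTop (𝓝 (-(z / g P a b p σ.1 w))) := fun σ => by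
    refine (((S.tendsto_rescale z).div (S.tendsto_g hw σ) (S.g_ne_zero hw σ)).neg).congr' ?_
    filter_upwards [eventually_ge_atTop σ.len] with n hn
    simp only [F, (σ.len_le_iff n).1 hn, if_true, Pi.div_apply]
    rw [mul_div_mul_left _ _ (pow_ne_zero n ha)]
  have h3 : ∀ n σ, ‖F n σ‖ ≤ C * K * ‖a‖⁻¹ ^ σ.len := fun n σ => by
    by_cases hσ : σ ∈ Stable.level d n
    · have hpos : 0 < ‖orbit p σ.1 w n - b‖ :=
        norm_pos_iff.2 (sub_ne_zero.2 (S.orbit_ne_fixed hw σ.1 n))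
      have hN := S.norm_pos
      have hb := hbd σ n ((σ.len_le_iff n).2 hσ)
      simp only [F, hσ, if_true, norm_neg, norm_div]
      rw [inv_pow, ← div_eq_mul_inv, div_le_div_iff₀ hpos (by positivity)]
      have hx : 0 < ‖a‖ ^ n := by positivity
      refine le_of_mul_le_mul_left ?_ hx
      calc ‖a‖ ^ n * (‖f (z / a ^ n) - b‖ * ‖a‖ ^ σ.len)
          = (‖a‖ ^ n * ‖f (z / a ^ n) - b‖) * ‖a‖ ^ σ.len := by ring
        _ ≤ C * (K * (‖a‖ ^ n * ‖orbit p σ.1 w n - b‖)) :=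
            mul_le_mul (hC' n) hb (by positivity) hC0
        _ = _ := by ring
    · simp only [F, hσ, if_false, norm_zero]
      positivity
  have h4 := tendsto_tprod_one_add_of_dominated_convergence
    (S.summable_inv_pow_len.mul_left (C * K)) h2 (.of_forall h3)
  simp only [h1] at h4
  simpa only [sub_eq_add_neg] using (tendsto_nhds_unique h4 tendsto_const_nhds)

theorem apply_eq_tprod {w : ℂ} (hw : w ≠ b) (z : ℂ) :
    f z = w + (b - w) * ∏' σ : Stable d, (1 - z / g P a b p σ.1 w) := by
  rw [S.tprod_one_sub_div_g hw, mul_div_cancel₀ _ (sub_ne_zero.2 hw.symm)]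
  ring

end IsPoincareSystem

/-! ### The factorization for `w = b` -/

/-- A sequence in `StableNe d` is a nonzero first entry followed by an eventually zero sequence. -/
def StableNe.consEquiv (d : ℕ) [NeZero d] : {j : Fin d // j ≠ 0} × Stable d ≃ StableNe d where
  toFun x := ⟨Stable.consEquiv d (x.1.1, x.2), x.1.2⟩
  invFun σ := (⟨σ.1.1 0, σ.2⟩, ((Stable.consEquiv d).symm σ.1).2)
  left_inv _ := rfl
  right_inv σ := Subtype.ext ((Stable.consEquiv d).apply_symm_apply σ.1)

namespace IsPoincareSystem

variable {d : ℕ} [NeZero d] {P : ℂ[X]} {a b : ℂ} {f : ℂ → ℂ} {p : Fin d → ℂ → ℂ}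
  (S : IsPoincareSystem P a b f p)

theorem gZero_consEquiv (x : {j : Fin d // j ≠ 0} × Stable d) :
    gZero P a b p (StableNe.consEquiv d x).1.1 = a * g P a b p x.2.1 (p x.1.1 b) := by
  rw [gZero, g, mul_assoc]
  congr 2
  refine tprod_congr fun n => ?_
  change a / (Q P b).eval (orbit p (Stable.consEquiv d (x.1.1, x.2)).1 b (n + 1 + 1)) = _
  rw [Stable.orbit_consEquiv]

include S

/-- Since `P' b = a ≠ 0`, `b` is a simple solution of `P z = b`, already taken by `p 0`. -/
theorem branch_fixed_ne {j : Fin d} (hj : j ≠ 0) : p j b ≠ b := fun h =>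
  hj (S.branch_injective (w := b) (i := j) (j := 0) (by rw [h, S.branch_fixed])
    (by rw [h, ← S.multiplier_eq]; exact S.ne_zero))

theorem gZero_ne_zero (σ : StableNe d) : gZero P a b p σ.1.1 ≠ 0 := by
  obtain ⟨x, rfl⟩ := (StableNe.consEquiv d).surjective σ
  rw [gZero_consEquiv]
  exact mul_ne_zero S.ne_zero (S.g_ne_zero (S.branch_fixed_ne x.1.2) x.2)

theorem multipliable_div_Q_fixed (σ : StableNe d) :
    Multipliable fun n : ℕ => a / (Q P b).eval (orbit p σ.1.1 b (n + 2)) := by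
  obtain ⟨x, rfl⟩ := (StableNe.consEquiv d).surjective σ
  refine (S.multipliable_div_Q x.2 (p x.1.1 b)).congr fun n => ?_
  change _ = a / (Q P b).eval (orbit p (Stable.consEquiv d (x.1.1, x.2)).1 b (n + 1 + 1))
  rw [Stable.orbit_consEquiv]

theorem summable_norm_inv_gZero :
    Summable fun σ : StableNe d => ‖(gZero P a b p σ.1.1)⁻¹‖ := by
  refine (StableNe.consEquiv d).summable_iff.1
    ((summable_prod_of_nonneg fun _ => norm_nonneg _).2 ⟨fun j => ?_, .of_finite⟩)
  refine ((S.summable_norm_inv_g (S.branch_fixed_ne j.2)).mul_left ‖a⁻¹‖).congr fun σ => ?_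
  rw [gZero_consEquiv, mul_inv, norm_mul]

theorem summable_norm_inv_pow_mul_gZero :
    Summable fun x : ℕ × StableNe d => ‖(a ^ x.1 * gZero P a b p x.2.1.1)⁻¹‖ := by
  have h1 : ‖a⁻¹‖ < 1 := by rw [norm_inv]; exact inv_lt_one_of_one_lt₀ S.one_lt_norm
  refine ((summable_geometric_of_lt_one (norm_nonneg _) h1).mul_of_nonneg
    S.summable_norm_inv_gZero (fun n => by positivity) fun _ => norm_nonneg _).congr fun x => ?_
  rw [mul_inv, norm_mul, ← inv_pow, norm_pow]

theorem summable_norm_div_pow_mul_gZero (z : ℂ) :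
    Summable fun x : ℕ × StableNe d => ‖-(z / (a ^ x.1 * gZero P a b p x.2.1.1))‖ := by
  refine (S.summable_norm_inv_pow_mul_gZero.mul_left ‖z‖).congr fun x => ?_
  rw [norm_neg, div_eq_mul_inv, norm_mul]

theorem multipliable_pow_mul_gZero (z : ℂ) : Multipliable fun x : ℕ × StableNe d =>
    1 - z / (a ^ x.1 * gZero P a b p x.2.1.1) := by
  simpa only [sub_eq_add_neg] using
    multipliable_one_add_of_summable (S.summable_norm_div_pow_mul_gZero z)

theorem multipliable_pow_mul_gZero_left (z : ℂ) (m : ℕ) : Multipliable fun σ : StableNe d =>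
    1 - z / (a ^ m * gZero P a b p σ.1.1) := by
  simpa only [sub_eq_add_neg, Function.comp_def] using multipliable_one_add_of_summable
    ((S.summable_norm_div_pow_mul_gZero z).comp_injective
      (i := fun σ : StableNe d => (m, σ)) fun _ _ h => (Prod.ext_iff.1 h).2)

theorem multipliable_pow_mul_gZero_right (z : ℂ) (σ : StableNe d) : Multipliable fun m : ℕ =>
    1 - z / (a ^ m * gZero P a b p σ.1.1) := by
  simpa only [sub_eq_add_neg, Function.comp_def] using multipliable_one_add_of_summable
    ((S.summable_norm_div_pow_mul_gZero z).comp_injective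
      (i := fun m : ℕ => (m, σ)) fun _ _ h => (Prod.ext_iff.1 h).1)

theorem eval_sub_fixed_eq_prod (v : ℂ) : P.eval v - b =
    P.leadingCoeff * ((v - b) * ∏ j : {j : Fin d // j ≠ 0}, (v - p j.1 b)) := by
  rw [S.eval_sub_eq_prod, ← Finset.mul_prod_erase _ _ (Finset.mem_univ (0 : Fin d)),
    S.branch_fixed, ← Finset.prod_subtype (Finset.univ.erase 0) (fun j => by simp) fun j => v - p j b]

theorem multiplier_eq_prod :
    a = P.leadingCoeff * ∏ j : {j : Fin d // j ≠ 0}, (b - p j.1 b) := by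
  have h : P = C b + C P.leadingCoeff *
      ((X - C b) * ∏ j : {j : Fin d // j ≠ 0}, (X - C (p j.1 b))) := by
    refine Polynomial.funext fun v => ?_
    have := S.eval_sub_fixed_eq_prod v
    simp only [eval_add, eval_mul, eval_sub, eval_X, eval_C, eval_prod]
    rw [← this]
    ring
  have h2 := congrArg (fun q : ℂ[X] => q.derivative.eval b) h
  simp only [← S.multiplier_eq, derivative_add, derivative_C, derivative_mul, eval_add,
    eval_mul, eval_C, eval_sub, eval_X, derivative_sub, derivative_X] at h2
  rw [h2]
  simp [eval_prod]

/-- Grouping by the first symbol `j` leaves the product already known at the point `p j b`, with `z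
/ a` in place of `z`. -/
theorem tprod_one_sub_div_gZero (z : ℂ) :
    ∏' σ : StableNe d, (1 - z / gZero P a b p σ.1.1) =
      ∏ j : {j : Fin d // j ≠ 0}, (f (z / a) - p j.1 b) / (b - p j.1 b) := by
  have h0 := S.multipliable_pow_mul_gZero_left z 0
  simp only [pow_zero, one_mul] at h0
  rw [← (StableNe.consEquiv d).tprod_eq]
  have h1 := (StableNe.consEquiv d).multipliable_iff.2 h0
  simp only [Function.comp_def, gZero_consEquiv, ← div_div] at h1 ⊢
  rw [h1.tprod_prod' fun j => S.multipliable_one_sub_div_g (S.branch_fixed_ne j.2) (z / a),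
    tprod_fintype]
  exact Finset.prod_congr rfl fun j _ => S.tprod_one_sub_div_g (S.branch_fixed_ne j.2) (z / a)

/-- The factorization of `P v - b` at `v = f (z / a)`, with the leading coefficient eliminated
through `multiplier_eq_prod`. -/
theorem apply_sub_fixed (z : ℂ) : f z - b =
    a * (f (z / a) - b) * ∏' σ : StableNe d, (1 - z / gZero P a b p σ.1.1) := by
  have h : ∏ j : {j : Fin d // j ≠ 0}, (b - p j.1 b) ≠ 0 :=
    Finset.prod_ne_zero_iff.2 fun j _ => sub_ne_zero.2 (S.branch_fixed_ne j.2).symm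
  rw [S.tprod_one_sub_div_gZero, Finset.prod_div_distrib, ← S.map_div z,
    S.eval_sub_fixed_eq_prod]
  have h1 := S.multiplier_eq_prod
  generalize f (z / a) = v
  generalize (∏ j : {j : Fin d // j ≠ 0}, (b - p j.1 b)) = c at h h1 ⊢
  rw [h1]
  field_simp

theorem apply_sub_fixed_pow (z : ℂ) (n : ℕ) : f z - b =
    a ^ n * (f (z / a ^ n) - b) * ∏ m ∈ Finset.range n,
      ∏' σ : StableNe d, (1 - z / (a ^ m * gZero P a b p σ.1.1)) := by
  induction n with
  | zero => simp
  | succ n ih =>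
    rw [ih, Finset.prod_range_succ, S.apply_sub_fixed (z / a ^ n)]
    simp only [div_div]
    rw [pow_succ]
    ring

theorem apply_eq_tprod_tprod (z : ℂ) : f z = b + z * ∏' m : ℕ, ∏' σ : StableNe d,
    (1 - z / (a ^ m * gZero P a b p σ.1.1)) := by
  have h := ((S.multipliable_pow_mul_gZero z).hasProd.prod_fiberwise
    fun m => (S.multipliable_pow_mul_gZero_left z m).hasProd)
  rw [h.tprod_eq]
  have h1 := ((S.tendsto_rescale z).mul h.tendsto_prod_nat)
  rw [← sub_eq_iff_eq_add']
  refine tendsto_nhds_unique (tendsto_const_nhds.congr fun n => ?_) h1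
  exact S.apply_sub_fixed_pow z n

theorem apply_eq_qPochhammer (z : ℂ) : f z =
    b + qPochhammer (fun σ : StableNe d => z / gZero P a b p σ.1.1) (1 / a) * z := by
  rw [S.apply_eq_tprod_tprod z, mul_comm z, qPochhammer]
  congr 2
  have h := Multipliable.tprod_comm' (f := fun (m : ℕ) (σ : StableNe d) =>
    1 - z / (a ^ m * gZero P a b p σ.1.1)) (S.multipliable_pow_mul_gZero z)
    (S.multipliable_pow_mul_gZero_left z) (S.multipliable_pow_mul_gZero_right z)
  rw [← h]
  refine tprod_congr fun σ => tprod_congr fun m => ?_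
  rw [one_div, inv_pow, ← div_eq_mul_inv, div_div, mul_comm]

end IsPoincareSystem

/-! ### Newton's identities, formal power series and Bell polynomials -/

/-- The Taylor series at `0`. -/
noncomputable def taylorSeries (f : ℂ → ℂ) : PowerSeries ℂ :=
  PowerSeries.mk fun n => iteratedDeriv n f 0 / (n ! : ℂ)

@[simp]
theorem coeff_taylorSeries (f : ℂ → ℂ) (n : ℕ) :
    PowerSeries.coeff n (taylorSeries f) = iteratedDeriv n f 0 / (n ! : ℂ) :=
  PowerSeries.coeff_mk _ _

theorem taylorSeries_mul {f h : ℂ → ℂ} (hf : AnalyticAt ℂ f 0) (hh : AnalyticAt ℂ h 0) :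
    taylorSeries (f * h) = taylorSeries f * taylorSeries h := by
  ext n
  simp only [coeff_taylorSeries, PowerSeries.coeff_mul,
    iteratedDeriv_mul hf.contDiffAt hh.contDiffAt,
    Finset.Nat.sum_antidiagonal_eq_sum_range_succ_mk, Finset.sum_div]
  refine Finset.sum_congr rfl fun i hi => ?_
  rw [Nat.cast_choose _ (by grind)]
  field_simp [Nat.factorial_ne_zero]

theorem taylorSeries_deriv (f : ℂ → ℂ) :
    taylorSeries (deriv f) = PowerSeries.derivative ℂ (taylorSeries f) := by
  ext n
  rw [PowerSeries.coeff_derivative, coeff_taylorSeries, coeff_taylorSeries, ← iteratedDeriv_succ',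
    Nat.factorial_succ]
  push_cast
  have : (n : ℂ) + 1 ≠ 0 := by exact_mod_cast n.succ_ne_zero
  field_simp [Nat.factorial_ne_zero]

theorem taylorSeries_congr {f h : ℂ → ℂ} (hfh : f =ᶠ[𝓝 0] h) :
    taylorSeries f = taylorSeries h := by
  ext n
  simp only [coeff_taylorSeries, hfh.iteratedDeriv_eq n]

theorem analyticAt_and_taylorSeries_eq {h : ℂ → ℂ} {c : ℕ → ℂ}
    (H : ∀ᶠ z in 𝓝 (0 : ℂ), HasSum (fun n => z ^ n * c n) (h z)) :
    AnalyticAt ℂ h 0 ∧ taylorSeries h = PowerSeries.mk c := by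
  have h1 : HasFPowerSeriesAt h (FormalMultilinearSeries.ofScalars ℂ c) 0 := by
    rw [hasFPowerSeriesAt_iff]
    simpa only [FormalMultilinearSeries.coeff_ofScalars, zero_add, smul_eq_mul] using H
  refine ⟨h1.analyticAt, ?_⟩
  have h2 := h1.analyticAt.hasFPowerSeriesAt.eq_formalMultilinearSeries h1
  ext n
  have h3 := congrArg (fun q => FormalMultilinearSeries.coeff q n) h2
  simpa only [FormalMultilinearSeries.coeff_ofScalars, coeff_taylorSeries,
    PowerSeries.coeff_mk] using h3

section PowerSums

variable {ι : Type*} {s : ι → ℂ} {F : ℂ → ℂ}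

/-- The logarithmic derivative of `∏ (1 - s i * z)` generates the power sums of `s`. -/
theorem eventually_hasSum_neg_logDeriv (hs : Summable fun i => ‖s i‖)
    (hF : ∀ z, F z = ∏' i, (1 - s i * z)) :
    ∀ᶠ z in 𝓝 (0 : ℂ), F z ≠ 0 ∧
      HasSum (fun n => z ^ n * ∑' i, s i ^ (n + 1)) (-logDeriv F z) := by
  set T := ∑' i, ‖s i‖ with hT
  have hT0 : 0 ≤ T := tsum_nonneg fun _ => norm_nonneg _
  have hle : ∀ i, ‖s i‖ ≤ T := fun i => hs.le_tsum i fun _ _ => norm_nonneg _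
  -- This radius gives `‖s i * z‖ ≤ 1 / 2` for all `i` at once.
  set r : ℝ := 1 / (2 * (T + 1)) with hr
  have hr0 : 0 < r := by positivity
  have hball : ∀ z : ℂ, z ∈ Metric.ball 0 r → ∀ i, ‖s i * z‖ ≤ 1 / 2 := fun z hz i => by
    rw [mem_ball_zero_iff] at hz
    rw [norm_mul]
    calc ‖s i‖ * ‖z‖ ≤ (T + 1) * r := mul_le_mul (by linarith [hle i]) hz.le (norm_nonneg _)
          (by positivity)
      _ = 1 / 2 := by rw [hr]; field_simp
  filter_upwards [Metric.ball_mem_nhds (0 : ℂ) hr0] with z hz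
  have hlt : ∀ i, ‖s i * z‖ < 1 := fun i => (hball z hz i).trans_lt (by norm_num)
  have hne : ∀ i, 1 - s i * z ≠ 0 := fun i h => by
    have := hlt i
    rw [← sub_eq_zero.1 h, norm_one] at this
    exact lt_irrefl _ this
  have hsz : Summable fun i => ‖-(s i * z)‖ := by
    refine (hs.mul_right ‖z‖).congr fun i => ?_
    rw [norm_neg, norm_mul]
  have hFz : F z ≠ 0 := by
    rw [hF]
    simpa only [sub_eq_add_neg] using
      tprod_one_add_ne_zero_of_summable (f := fun i => -(s i * z))
        (by simpa only [← sub_eq_add_neg] using hne) hsz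
  refine ⟨hFz, ?_⟩
  have hlog : ∀ i, logDeriv (fun z => 1 - s i * z) z = -(s i * (1 - s i * z)⁻¹) := fun i => by
    have : HasDerivAt (fun z => 1 - s i * z) (-s i) z := by
      simpa using ((hasDerivAt_id z).const_mul (s i)).const_sub 1
    rw [logDeriv_apply, this.deriv, div_eq_mul_inv, neg_mul]
  -- Absolute summability of the double series allows summing over `n` first (geometric series) or
  -- over `i` first (power sums).
  have hdouble : Summable fun x : ι × ℕ => z ^ x.2 * s x.1 ^ (x.2 + 1) := by
    refine (hs.mul_of_nonneg (summable_geometric_of_lt_one (r := (1 / 2 : ℝ)) (by norm_num)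
      (by norm_num)) (fun _ => norm_nonneg _) fun n => by positivity).of_norm_bounded fun x => ?_
    calc ‖z ^ x.2 * s x.1 ^ (x.2 + 1)‖ = ‖s x.1‖ * ‖s x.1 * z‖ ^ x.2 := by
          rw [← norm_pow, ← norm_mul]; congr 1; ring
      _ ≤ ‖s x.1‖ * (1 / 2) ^ x.2 := by gcongr; exact hball z hz x.1
  have h1 : HasSum (fun i => s i * (1 - s i * z)⁻¹) _ :=
    hdouble.hasSum.prod_fiberwise fun i => by
      refine ((hasSum_geometric_of_norm_lt_one (hlt i)).mul_left (s i)).congr_fun ?_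
      intro n
      ring
  have h2 : HasSum (fun n => z ^ n * ∑' i, s i ^ (n + 1)) _ :=
    ((Equiv.prodComm ℕ ι).hasSum_iff.2 hdouble.hasSum).prod_fiberwise fun n => by
      rw [← tsum_mul_left]
      exact (hdouble.prod_symm.prod_factor n).hasSum
  have h3 : logDeriv F z = ∑' i, logDeriv (fun z => 1 - s i * z) z := by
    rw [_root_.funext hF]
    refine logDeriv_tprod_eq_tsum (s := Metric.ball 0 r) Metric.isOpen_ball hz hne
      (fun i => by fun_prop) ?_ ?_ (by rwa [← hF])
    · simp only [hlog]
      exact h1.summable.neg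
    · have := Summable.multipliableLocallyUniformlyOn_one_add (f := fun i z => -(s i * z))
        (K := Metric.ball (0 : ℂ) r) (u := fun i => ‖s i‖ * r) Metric.isOpen_ball
        (hs.mul_right r) (.of_forall fun i x hx => by
          rw [norm_neg, norm_mul]
          gcongr
          exact (mem_ball_zero_iff.1 hx).le) (fun i => by fun_prop)
      simpa only [← sub_eq_add_neg] using this
  rw [h3]
  simp only [hlog, tsum_neg, neg_neg, h1.tsum_eq]
  exact h2

/-- Newton's identities for infinite products, in the form of a formal differential equation. -/
theorem derivative_taylorSeries_tprod (hs : Summable fun i => ‖s i‖)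
    (hF : ∀ z, F z = ∏' i, (1 - s i * z)) (hd : Differentiable ℂ F) :
    PowerSeries.derivative ℂ (taylorSeries F) =
      -(taylorSeries F * PowerSeries.mk fun n => ∑' i, s i ^ (n + 1)) := by
  have H := eventually_hasSum_neg_logDeriv hs hF
  obtain ⟨h1, h2⟩ := analyticAt_and_taylorSeries_eq (H.mono fun z hz => hz.2)
  have h3 : (fun z => -deriv F z) =ᶠ[𝓝 0] F * fun z => -logDeriv F z := by
    filter_upwards [H] with z hz
    rw [Pi.mul_apply, logDeriv_apply, mul_neg, mul_div_cancel₀ _ hz.1]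
  rw [← taylorSeries_deriv, ← h2, ← taylorSeries_mul (hd.analyticAt 0) h1,
    ← taylorSeries_congr h3]
  ext n
  simp [iteratedDeriv_fun_neg, neg_div]

end PowerSums

/-- Solving Newton's identities: if `u' = (1 - u) T`, then `T = -(log (1 - u))'`. -/
theorem coeff_eq_sum_coeff_pow {u T : PowerSeries ℂ} (h0 : PowerSeries.coeff 0 u = 0)
    (h : PowerSeries.derivative ℂ u = (1 - u) * T) {m : ℕ} (hm : 1 ≤ m) :
    PowerSeries.coeff (m - 1) T =
      ∑ j ∈ Finset.Icc 1 m, (m : ℂ) / j * PowerSeries.coeff m (u ^ j) := by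
  -- The geometric series for `1 / (1 - u)`, cut off at `m`. The remainder `u ^ m * T` is divisible
  -- by `X ^ m` and does not reach the coefficient `m - 1`.
  have h1 : T - u ^ m * T = ∑ j ∈ Finset.range m, u ^ j * PowerSeries.derivative ℂ u := by
    rw [← Finset.sum_mul, h, ← mul_assoc, geom_sum_mul_neg, sub_mul, one_mul]
  have h2 : PowerSeries.coeff (m - 1) (u ^ m * T) = 0 := by
    have h3 : PowerSeries.X ^ m ∣ u ^ m := pow_dvd_pow_of_dvd
      (PowerSeries.X_dvd_iff.2 (by rwa [← PowerSeries.coeff_zero_eq_constantCoeff_apply])) m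
    exact PowerSeries.X_pow_dvd_iff.1 (h3.mul_right T) _ (by omega)
  have h4 := congrArg (PowerSeries.coeff (m - 1)) h1
  rw [map_sub, h2, sub_zero, map_sum] at h4
  rw [h4, Finset.range_eq_Ico, Finset.sum_Ico_eq_sum_range, ← Finset.Ico_succ_right_eq_Icc,
    Finset.sum_Ico_eq_sum_range]
  refine Finset.sum_congr (by simp) fun j _ => ?_
  obtain ⟨n, rfl⟩ := Nat.exists_eq_add_of_le' hm
  have h5 : PowerSeries.derivative ℂ (u ^ (j + 1)) =
      PowerSeries.C ((j : ℂ) + 1) * (u ^ j * PowerSeries.derivative ℂ u) := by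
    rw [Derivation.leibniz_pow, Nat.add_sub_cancel, nsmul_eq_mul, smul_eq_mul]
    simp
  have h6 := congrArg (PowerSeries.coeff n) h5
  rw [PowerSeries.coeff_derivative, PowerSeries.coeff_C_mul] at h6
  have hj : (j : ℂ) + 1 ≠ 0 := by exact_mod_cast j.succ_ne_zero
  rw [zero_add, add_comm 1 j, Nat.add_sub_cancel]
  push_cast
  field_simp
  linear_combination -h6

/-- The multinomial theorem for power series. -/
theorem coeff_mk_pow (c : ℕ → ℂ) (n j : ℕ) :
    PowerSeries.coeff n (PowerSeries.mk c ^ j) =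
      ∑ k ∈ ((Finset.univ : Finset (Fin (n + 1))).piAntidiag j).filter
        (fun k : Fin (n + 1) → ℕ => ∑ i : Fin (n + 1), (i : ℕ) * k i = n),
        (Nat.multinomial Finset.univ k : ℂ) * ∏ i : Fin (n + 1), c i ^ k i := by
  -- Coefficients above `n` do not affect coefficient `n` of the power, so the finite multinomial
  -- theorem applies to the truncation.
  set θ : PowerSeries ℂ := ∑ i : Fin (n + 1), PowerSeries.C (c i) * PowerSeries.X ^ (i : ℕ) with hθ
  have h1 : PowerSeries.X ^ (n + 1) ∣ PowerSeries.mk c - θ := by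
    refine PowerSeries.X_pow_dvd_iff.2 fun m hm => ?_
    rw [map_sub, PowerSeries.coeff_mk, hθ, map_sum, sub_eq_zero]
    simp only [PowerSeries.coeff_C_mul, PowerSeries.coeff_X_pow]
    rw [Finset.sum_eq_single (⟨m, hm⟩ : Fin (n + 1))]
    · simp
    · intro i _ hi
      have : m ≠ i := fun h => hi (Fin.ext h.symm)
      simp [this]
    · simp
  have h2 := PowerSeries.X_pow_dvd_iff.1 (h1.trans (sub_dvd_pow_sub_pow _ _ j)) n (by omega)
  rw [map_sub, sub_eq_zero] at h2
  rw [h2, hθ, Finset.sum_pow_eq_sum_piAntidiag, map_sum, Finset.sum_filter]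
  refine Finset.sum_congr rfl fun k _ => ?_
  have h3 : ((Nat.multinomial Finset.univ k : ℕ) : PowerSeries ℂ) *
      ∏ i : Fin (n + 1), (PowerSeries.C (c i) * PowerSeries.X ^ (i : ℕ)) ^ k i =
      PowerSeries.C ((Nat.multinomial Finset.univ k : ℂ) * ∏ i : Fin (n + 1), c i ^ k i) *
        PowerSeries.X ^ (∑ i : Fin (n + 1), (i : ℕ) * k i) := by
    simp only [mul_pow, Finset.prod_mul_distrib, ← pow_mul, Finset.prod_pow_eq_pow_sum, map_mul,
      map_prod, map_pow, map_natCast, mul_assoc]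
  rw [h3, PowerSeries.coeff_C_mul, PowerSeries.coeff_X_pow]
  simp only [eq_comm (a := n), mul_ite, mul_one, mul_zero]

/-- Dividing `ψ` by `X` lowers the target degree to `m - j`, hence the `m - j + 1` variables. The
weight condition shifts by `∑ k i = j`. -/
theorem bell_eq_coeff {m j : ℕ} (hjm : j ≤ m) {x : ℕ → ℂ} {ψ : PowerSeries ℂ}
    (h0 : PowerSeries.coeff 0 ψ = 0)
    (hψ : ∀ i, PowerSeries.coeff (i + 1) ψ = x (i + 1) / ((i + 1)! : ℂ)) :
    bell m j x = (m ! : ℂ) / (j ! : ℂ) * PowerSeries.coeff m (ψ ^ j) := by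
  have h1 : ψ = PowerSeries.X * PowerSeries.mk fun i => x (i + 1) / ((i + 1)! : ℂ) := by
    ext n
    cases n with
    | zero => simpa using h0
    | succ n => rw [PowerSeries.coeff_succ_X_mul, hψ, PowerSeries.coeff_mk]
  have h2 : PowerSeries.coeff m (ψ ^ j) =
      PowerSeries.coeff (m - j) ((PowerSeries.mk fun i => x (i + 1) / ((i + 1)! : ℂ)) ^ j) := by
    obtain ⟨n, rfl⟩ := Nat.exists_eq_add_of_le' hjm
    rw [h1, mul_pow, PowerSeries.coeff_X_pow_mul, Nat.add_sub_cancel]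
  rw [h2, coeff_mk_pow, bell, Finset.mul_sum]
  refine Finset.sum_congr (Finset.filter_congr fun k hk => ?_) fun k hk => ?_
  · have hk' : ∑ i, k i = j := (Finset.mem_piAntidiag.1 hk).1
    simp only [add_mul, one_mul, Finset.sum_add_distrib, hk']
    omega
  · have hk' : ∑ i, k i = j := (Finset.mem_piAntidiag.1 (Finset.mem_filter.1 hk).1).1
    have h3 := Nat.multinomial_spec Finset.univ k
    rw [hk'] at h3
    have h4 : (∏ i, ((k i)! : ℂ)) * (Nat.multinomial Finset.univ k : ℂ) = (j ! : ℂ) := by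
      exact_mod_cast h3
    have h5 : (∏ i, ((k i)! : ℂ)) ≠ 0 :=
      Finset.prod_ne_zero_iff.2 fun i _ => by exact_mod_cast Nat.factorial_ne_zero _
    have h6 : (j ! : ℂ) ≠ 0 := by exact_mod_cast Nat.factorial_ne_zero _
    rw [← mul_assoc]
    congr 1
    rw [← h4] at h6 ⊢
    have h7 := right_ne_zero_of_mul h6
    field_simp

theorem coeff_taylorSeries_sub (f : ℂ → ℂ) (b : ℂ) (i : ℕ) :
    PowerSeries.coeff (i + 1) (taylorSeries f - .C b) =
    iteratedDeriv (i + 1) f 0 / ((i + 1)! : ℂ) := by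
  rw [map_sub, coeff_taylorSeries, PowerSeries.coeff_C, if_neg i.succ_ne_zero, sub_zero]

/-! ### The momenta formulas -/

namespace IsPoincareSystem

variable {d : ℕ} [NeZero d] {P : ℂ[X]} {a b : ℂ} {f : ℂ → ℂ} {p : Fin d → ℂ → ℂ}
  (S : IsPoincareSystem P a b f p)
include S

/-- Newton's identities for `F = (f - w) / (b - w)`, which has the numbers `g` as zeros and
satisfies `1 - F = (f - b) / (w - b)`. -/
theorem tsum_inv_g_pow {w : ℂ} (hw : w ≠ b) {m : ℕ} (hm : 1 ≤ m) :
    (w - b) ^ m * ∑' σ : Stable d, (g P a b p σ.1 w)⁻¹ ^ m = ∑ j ∈ Finset.Icc 1 m,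
      (w - b) ^ (m - j) * ((m : ℂ) / j * PowerSeries.coeff m ((taylorSeries f - .C b) ^ j)) := by
  have hwb : w - b ≠ 0 := sub_ne_zero.2 hw
  have hbw : b - w ≠ 0 := sub_ne_zero.2 hw.symm
  set F : ℂ → ℂ := fun z => (b - w)⁻¹ * (f z - w) with hF
  have hFd : Differentiable ℂ F := (S.differentiable.sub_const w).const_mul _
  have hFp : ∀ z, F z = ∏' σ : Stable d, (1 - (g P a b p σ.1 w)⁻¹ * z) := fun z => by
    simp only [inv_mul_eq_div, hF, S.tprod_one_sub_div_g hw]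
  have hN := derivative_taylorSeries_tprod (S.summable_norm_inv_g hw) hFp hFd
  set u : PowerSeries ℂ := 1 - taylorSeries F with hu
  have huψ : taylorSeries f - .C b = .C (w - b) * u := by
    ext n
    rw [PowerSeries.coeff_C_mul, hu, map_sub, map_sub, PowerSeries.coeff_C, PowerSeries.coeff_one,
      coeff_taylorSeries, coeff_taylorSeries]
    cases n with
    | zero =>
      simp only [iteratedDeriv_zero, hF, S.map_zero, Nat.factorial_zero, Nat.cast_one, div_one,
        if_true]
      field_simp
      ring
    | succ n =>
      have hderiv : deriv F = fun z => (b - w)⁻¹ * deriv f z := by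
        ext z
        simp only [hF, deriv_const_mul_field, deriv_sub_const]
      rw [iteratedDeriv_succ', iteratedDeriv_succ', hderiv, iteratedDeriv_const_mul_field]
      have h1 : (w - b) * (b - w)⁻¹ = -1 := by
        rw [← neg_sub, neg_mul, mul_inv_cancel₀ hbw]
      simp only [Nat.add_eq_zero_iff, one_ne_zero, and_false, if_false, sub_zero, zero_sub]
      linear_combination (iteratedDeriv n (deriv f) 0 / ((n + 1)! : ℂ)) * h1
  have h0 : PowerSeries.coeff 0 u = 0 := by
    rw [hu, map_sub, coeff_taylorSeries]
    simp [hF, S.map_zero, hbw]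
  have h1 : PowerSeries.derivative ℂ u = (1 - u) * PowerSeries.mk fun n =>
      ∑' σ : Stable d, (g P a b p σ.1 w)⁻¹ ^ (n + 1) := by
    rw [hu, map_sub, hN, sub_neg_eq_add, sub_sub_cancel]
    simp
  have h2 := coeff_eq_sum_coeff_pow h0 h1 hm
  rw [PowerSeries.coeff_mk, Nat.sub_add_cancel hm] at h2
  rw [h2, Finset.mul_sum]
  refine Finset.sum_congr rfl fun j hj => ?_
  obtain ⟨-, hj⟩ := Finset.mem_Icc.1 hj
  rw [huψ, mul_pow, ← map_pow, PowerSeries.coeff_C_mul]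
  nth_rw 1 [← Nat.sub_add_cancel hj]
  rw [pow_add]
  ring

theorem coeff_zero_taylorSeries_sub : PowerSeries.coeff 0 (taylorSeries f - .C b) = 0 := by
  rw [map_sub, coeff_taylorSeries, PowerSeries.coeff_C, if_pos rfl]
  simp [S.map_zero]

/-- Differentiating `f (a z) = P (f z)` twice at `0` gives `a² f'' 0 = P'' b + a f'' 0`. -/
theorem iteratedDeriv_two :
    iteratedDeriv 2 f 0 = P.derivative.derivative.eval b / (a ^ 2 - a) := by
  have ha := S.ne_zero
  have ha1 : a - 1 ≠ 0 := sub_ne_zero.2 fun h => by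
    have := S.one_lt_norm
    rw [h, norm_one] at this
    exact lt_irrefl _ this
  have hd : ∀ z, a * deriv f (a * z) = P.derivative.eval (f z) * deriv f z := fun z => by
    have h1 : HasDerivAt (fun z => f (a * z)) (deriv f (a * z) * (a * 1)) z :=
      (S.differentiable (a * z)).hasDerivAt.comp z ((hasDerivAt_id z).const_mul a)
    have h2 : HasDerivAt (fun z => f (a * z)) (P.derivative.eval (f z) * deriv f z) z := by
      simp only [S.map_mul]
      exact (P.hasDerivAt (f z)).comp z (S.differentiable z).hasDerivAt
    rw [← h1.unique h2]
    ring
  have hdd : Differentiable ℂ (deriv f) := fun z =>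
    (S.differentiable.analyticAt z).deriv.differentiableAt
  have h1 : HasDerivAt (fun z => a * deriv f (a * z)) (a * (deriv (deriv f) (a * 0) * (a * 1))) 0 :=
    ((hdd (a * 0)).hasDerivAt.comp (0 : ℂ) ((hasDerivAt_id (0 : ℂ)).const_mul a)).const_mul a
  have h2 : HasDerivAt (fun z => a * deriv f (a * z))
      (P.derivative.derivative.eval (f 0) * deriv f 0 * deriv f 0 +
        P.derivative.eval (f 0) * deriv (deriv f) 0) 0 := by
    simp only [hd]
    exact ((P.derivative.hasDerivAt (f 0)).comp (0 : ℂ) (S.differentiable 0).hasDerivAt).mul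
      (hdd 0).hasDerivAt
  have h3 := h1.unique h2
  rw [mul_zero, S.map_zero, S.deriv_zero, ← S.multiplier_eq] at h3
  rw [iteratedDeriv_succ, iteratedDeriv_one, eq_div_iff (by
    rw [pow_two, ← mul_sub_one]; exact mul_ne_zero ha ha1)]
  linear_combination h3

theorem summable_inv_g_pow {w : ℂ} (hw : w ≠ b) {m : ℕ} (hm : 1 ≤ m) :
    Summable fun σ : Stable d => (g P a b p σ.1 w)⁻¹ ^ m := by
  have hs := S.summable_norm_inv_g hw
  obtain ⟨n, rfl⟩ := Nat.exists_eq_add_of_le' hm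
  set T := ∑' σ : Stable d, ‖(g P a b p σ.1 w)⁻¹‖
  refine (hs.mul_left (T ^ n)).of_norm_bounded fun σ => ?_
  rw [norm_pow, pow_succ]
  gcongr
  exact hs.le_tsum σ fun _ _ => norm_nonneg _

/-- The moments in terms of Taylor coefficients. -/
theorem hasSum_tprod_pow {w : ℂ} (hw : w ≠ b) {m : ℕ} (hm : 1 ≤ m) :
    HasSum (fun σ : Stable d => ∏' n : ℕ, (Q P b).eval (orbit p σ.1 w (n + 1)) ^ m / a ^ m)
      (∑ j ∈ Finset.Icc 1 m, (w - b) ^ (m - j) *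
        ((m : ℂ) / j * PowerSeries.coeff m ((taylorSeries f - .C b) ^ j))) := by
  rw [← S.tsum_inv_g_pow hw hm]
  refine ((S.summable_inv_g_pow hw hm).hasSum.mul_left ((w - b) ^ m)).congr_fun fun σ => ?_
  rw [(S.hasProd_Q_pow_div hw σ m).tprod_eq, div_eq_mul_inv, mul_pow]

theorem hasSum_tprod_one {w : ℂ} (hw : w ≠ b) :
    HasSum (fun σ : Stable d => ∏' n : ℕ, (Q P b).eval (orbit p σ.1 w (n + 1)) / a) 1 := by
  have h := S.hasSum_tprod_pow hw le_rfl
  simpa [coeff_taylorSeries_sub f b 0, iteratedDeriv_one, S.deriv_zero, -map_sub] using h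

theorem hasSum_tprod_two {w : ℂ} (hw : w ≠ b) :
    HasSum (fun σ : Stable d => ∏' n : ℕ, (Q P b).eval (orbit p σ.1 w (n + 1)) ^ 2 / a ^ 2)
      (1 - (b - w) * P.derivative.derivative.eval b / (a ^ 2 - a)) := by
  convert S.hasSum_tprod_pow hw one_le_two using 1
  have h : Finset.Icc 1 2 = {1, 2} := rfl
  have h1 : PowerSeries.coeff 1 (taylorSeries f - .C b) = 1 := by
    simpa [iteratedDeriv_one, S.deriv_zero, -map_sub] using coeff_taylorSeries_sub f b 0
  have h2 := coeff_taylorSeries_sub f b 1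
  rw [S.iteratedDeriv_two] at h2
  have h3 : PowerSeries.coeff 2 ((taylorSeries f - .C b) ^ 2) = 1 := by
    rw [pow_two, PowerSeries.coeff_mul, Finset.Nat.sum_antidiagonal_eq_sum_range_succ_mk]
    simp [-map_sub, Finset.sum_range_succ, S.coeff_zero_taylorSeries_sub, h1]
  rw [one_add_one_eq_two] at h2
  rw [h, Finset.sum_pair (by norm_num), h3, pow_one, h2]
  norm_num
  ring

theorem hasSum_tprod_bell {w : ℂ} (hw : w ≠ b) {m : ℕ} (hm : 1 ≤ m) :
    HasSum (fun σ : Stable d => ∏' n : ℕ, (Q P b).eval (orbit p σ.1 w (n + 1)) ^ m / a ^ m)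
      (∑ j ∈ Finset.Icc 1 m, (w - b) ^ (m - j) * ((j - 1)! : ℂ) / ((m - 1)! : ℂ) *
        bell m j (fun i => iteratedDeriv i f 0)) := by
  convert S.hasSum_tprod_pow hw hm using 1
  refine Finset.sum_congr rfl fun j hj => ?_
  obtain ⟨hj1, hj⟩ := Finset.mem_Icc.1 hj
  rw [bell_eq_coeff hj S.coeff_zero_taylorSeries_sub (coeff_taylorSeries_sub f b)]
  generalize PowerSeries.coeff m ((taylorSeries f - .C b) ^ j) = x
  generalize (w - b) ^ (m - j) = y
  obtain ⟨m, rfl⟩ := Nat.exists_eq_add_of_le' hm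
  obtain ⟨j, rfl⟩ := Nat.exists_eq_add_of_le' hj1
  simp only [Nat.add_sub_cancel, Nat.factorial_succ]
  have h1 : (j ! : ℂ) ≠ 0 := by exact_mod_cast j.factorial_ne_zero
  have h2 : (m ! : ℂ) ≠ 0 := by exact_mod_cast m.factorial_ne_zero
  have h3 : (j : ℂ) + 1 ≠ 0 := by exact_mod_cast j.succ_ne_zero
  push_cast
  field_simp

end IsPoincareSystem

/-! ### The order of growth -/

/-- A monotone solution of `L (q * r) = d * L r + O(1)` grows like a power of `r`. -/
theorem tendsto_log_div_log_of_rescaling {L : ℝ → ℝ} {d : ℕ} {q r₀ A : ℝ} (hd : 2 ≤ d)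
    (hq : 1 < q) (hr₀ : 0 < r₀) (hA : 0 ≤ A) (hmono : MonotoneOn L (Set.Ici r₀))
    (hge : ∀ r, r₀ ≤ r → A + 1 ≤ L r)
    (hlow : ∀ r, r₀ ≤ r → d * L r - A ≤ L (q * r))
    (hupp : ∀ r, r₀ ≤ r → L (q * r) ≤ d * L r + A) :
    Tendsto (fun s => Real.log (L s) / Real.log s) atTop (𝓝 (Real.log d / Real.log q)) := by
  have hd' : (2 : ℝ) ≤ d := by exact_mod_cast hd
  have hq0 : 0 < q := one_pos.trans hq
  have hmem : ∀ (n : ℕ) r, r₀ ≤ r → r₀ ≤ q ^ n * r := fun n r hr =>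
    hr.trans (le_mul_of_one_le_left (hr₀.le.trans hr) (one_le_pow₀ hq.le))
  -- Since `2 ≤ d` and `0 ≤ A`, the shifts `L - A` and `L + A` absorb the error term and turn the
  -- two inequalities into purely multiplicative ones.
  have hlown : ∀ (n : ℕ) r, r₀ ≤ r → d ^ n * (L r - A) ≤ L (q ^ n * r) - A := by
    intro n r hr
    induction n with
    | zero => simp
    | succ n ih =>
      have h1 := hlow _ (hmem n r hr)
      rw [pow_succ', pow_succ', mul_assoc, mul_assoc]
      nlinarith
  have huppn : ∀ (n : ℕ) r, r₀ ≤ r → L (q ^ n * r) + A ≤ d ^ n * (L r + A) := by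
    intro n r hr
    induction n with
    | zero => simp
    | succ n ih =>
      have h1 := hupp _ (hmem n r hr)
      rw [pow_succ', pow_succ', mul_assoc, mul_assoc]
      nlinarith
  set B := L (q * r₀) + A with hB
  have hqr : r₀ ≤ q * r₀ := le_mul_of_one_le_left hr₀.le hq.le
  have hB1 : 1 ≤ B := by linarith [hge _ hqr]
  have hlq : 0 < Real.log q := Real.log_pos hq
  have hld : 0 < Real.log d := Real.log_pos (by linarith)
  set α := Real.log d / Real.log q with hα
  have hα0 : 0 < α := div_pos hld hlq
  have hbound : ∀ s, r₀ ≤ s → |Real.log (L s) - α * Real.log s| ≤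
      α * |Real.log r₀| + α * Real.log q + Real.log B := by
    intro s hs
    -- Every `s ≥ r₀` is `q ^ n` times a point of `[r₀, q * r₀]`, where `1 ≤ L - A` and `L + A ≤ B`.
    obtain ⟨n, hn1, hn2⟩ := exists_nat_pow_near (x := s / r₀) (y := q)
      ((one_le_div hr₀).2 hs) hq
    rw [le_div_iff₀ hr₀] at hn1
    rw [div_lt_iff₀ hr₀] at hn2
    have hqn : 0 < q ^ n := pow_pos hq0 n
    have hs0 : 0 < s := hr₀.trans_le hs
    have hr1 : r₀ ≤ s / q ^ n := by rw [le_div_iff₀ hqn, mul_comm]; exact hn1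
    have hr2 : s / q ^ n ≤ q * r₀ := by
      rw [div_le_iff₀ hqn]
      rw [pow_succ] at hn2
      linarith
    have hsn : q ^ n * (s / q ^ n) = s := mul_div_cancel₀ _ hqn.ne'
    have hdn : (0 : ℝ) < d ^ n := by positivity
    have h1 : (d : ℝ) ^ n ≤ L s := by
      have h := hlown n _ hr1
      rw [hsn] at h
      have h' := le_mul_of_one_le_right hdn.le (show 1 ≤ L (s / q ^ n) - A by linarith [hge _ hr1])
      linarith
    have h2 : L s ≤ d ^ n * B := by
      have h := huppn n _ hr1
      rw [hsn] at h
      have h' := mul_le_mul_of_nonneg_left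
        (show L (s / q ^ n) + A ≤ B by linarith [hmono hr1 hqr hr2]) hdn.le
      linarith
    have h3 : n * Real.log d ≤ Real.log (L s) := by
      rw [← Real.log_pow]; exact Real.log_le_log hdn h1
    have h4 : Real.log (L s) ≤ n * Real.log d + Real.log B := by
      rw [← Real.log_pow, ← Real.log_mul hdn.ne' (by positivity)]
      exact Real.log_le_log (hdn.trans_le h1) h2
    have h5 : n * Real.log q + Real.log r₀ ≤ Real.log s := by
      rw [← Real.log_pow, ← Real.log_mul hqn.ne' hr₀.ne']
      exact Real.log_le_log (by positivity) hn1
    have h6 : Real.log s ≤ (n + 1) * Real.log q + Real.log r₀ := by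
      have : ((n : ℝ) + 1) = ((n + 1 : ℕ) : ℝ) := by push_cast; rfl
      rw [this, ← Real.log_pow, ← Real.log_mul (by positivity) hr₀.ne']
      exact Real.log_le_log hs0 hn2.le
    have h7 : Real.log d = α * Real.log q := by rw [hα]; field_simp
    rw [h7] at h3 h4
    have h8 := mul_le_mul_of_nonneg_left h5 hα0.le
    have h9 := mul_le_mul_of_nonneg_left h6 hα0.le
    have h10 := mul_le_mul_of_nonneg_left (le_abs_self (Real.log r₀)) hα0.le
    have h11 := mul_le_mul_of_nonneg_left (neg_abs_le (Real.log r₀)) hα0.le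
    have h12 := Real.log_nonneg hB1
    have h13 := mul_pos hα0 hlq
    rw [abs_le]
    constructor <;> nlinarith
  rw [tendsto_iff_norm_sub_tendsto_zero]
  refine squeeze_zero' (.of_forall fun _ => norm_nonneg _) ?_
    (tendsto_const_nhds (x := α * |Real.log r₀| + α * Real.log q + Real.log B).div_atTop
      Real.tendsto_log_atTop)
  filter_upwards [eventually_ge_atTop r₀, eventually_gt_atTop 1] with s hs hs1
  have hls : 0 < Real.log s := Real.log_pos hs1
  rw [Real.norm_eq_abs, div_sub' hls.ne', abs_div, abs_of_pos hls, mul_comm (Real.log s)]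
  gcongr
  exact hbound s hs

section MaxModulus

variable {f : ℂ → ℂ}

theorem exists_norm_eq_maxModulus (hf : Differentiable ℂ f) {r : ℝ} (hr : 0 ≤ r) :
    ∃ z, ‖z‖ = r ∧ ‖f z‖ = maxModulus f r := by
  obtain ⟨z, hz, h⟩ := (((isCompact_sphere (0 : ℂ) r).image
    hf.continuous.norm).sSup_mem ((NormedSpace.sphere_nonempty.2 hr).image _))
  exact ⟨z, by simpa using hz, h⟩

theorem norm_le_maxModulus (hf : Differentiable ℂ f) {r : ℝ} (hr : 0 < r) {z : ℂ}
    (hz : ‖z‖ ≤ r) : ‖f z‖ ≤ maxModulus f r := by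
  refine Complex.norm_le_of_forall_mem_frontier_norm_le (U := Metric.ball 0 r)
    Metric.isBounded_ball hf.diffContOnCl (fun x hx => ?_) ?_
  · rw [frontier_ball _ hr.ne'] at hx
    exact le_csSup ((isCompact_sphere (0 : ℂ) r).image hf.continuous.norm).bddAbove ⟨x, hx, rfl⟩
  · rw [closure_ball _ hr.ne']
    simpa using hz

theorem maxModulus_mono (hf : Differentiable ℂ f) {r s : ℝ} (hr : 0 < r) (hrs : r ≤ s) :
    maxModulus f r ≤ maxModulus f s := by
  obtain ⟨z, hz, h⟩ := exists_norm_eq_maxModulus hf hr.le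
  rw [← h]
  exact norm_le_maxModulus hf (hr.trans_le hrs) (hz.le.trans hrs)

end MaxModulus

namespace IsPoincareSystem

variable {d : ℕ} [NeZero d] {P : ℂ[X]} {a b : ℂ} {f : ℂ → ℂ} {p : Fin d → ℂ → ℂ}
  (S : IsPoincareSystem P a b f p)
include S

theorem exists_le_norm_apply (K : ℝ) : ∃ z, K ≤ ‖f z‖ := by
  by_contra! h
  have h1 : Bornology.IsBounded (Set.range f) :=
    isBounded_iff_forall_norm_le.2 ⟨K, by rintro _ ⟨z, rfl⟩; exact (h z).le⟩
  have h2 : f = fun _ => f 0 :=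
    _root_.funext fun z => S.differentiable.apply_eq_apply_of_bounded h1 z 0
  have h3 := S.deriv_zero
  rw [h2, deriv_const] at h3
  exact zero_ne_one h3

theorem exists_polynomial_bounds : ∃ K > 0, ∃ c > 0, ∀ v : ℂ,
    (∀ s, K ≤ s → ‖v‖ ≤ s → ‖P.eval v‖ ≤ c * (2 * s) ^ d) ∧
      (K ≤ ‖v‖ → c * (‖v‖ / 2) ^ d ≤ ‖P.eval v‖) := by
  -- All zeros of `P` have modulus at most `K / 2`, so each factor `v - p j 0` has modulus at least
  -- `‖v‖ / 2` once `K ≤ ‖v‖`.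
  set K := 2 * ∑ j, ‖p j 0‖ + 1 with hK
  have hle : ∀ j, ‖p j 0‖ ≤ K / 2 := fun j => by
    have := Finset.single_le_sum (f := fun j => ‖p j 0‖) (fun _ _ => norm_nonneg _)
      (Finset.mem_univ j)
    linarith
  have hlc : P.leadingCoeff ≠ 0 := leadingCoeff_ne_zero.2 fun h => by
    have := S.two_le
    rw [← S.natDegree_eq, h, natDegree_zero] at this
    omega
  have hnorm : ∀ v, ‖P.eval v‖ = ‖P.leadingCoeff‖ * ∏ j, ‖v - p j 0‖ := fun v => by
    rw [← norm_prod, ← norm_mul, ← S.eval_sub_eq_prod, sub_zero]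
  refine ⟨K, by positivity, ‖P.leadingCoeff‖, norm_pos_iff.2 hlc, fun v => ⟨fun s hs hv => ?_,
    fun hv => ?_⟩⟩
  · rw [hnorm]
    gcongr
    calc ∏ j, ‖v - p j 0‖ ≤ ∏ _j : Fin d, (2 * s) :=
          Finset.prod_le_prod (fun _ _ => norm_nonneg _) fun j _ => by
            have := norm_sub_le v (p j 0)
            linarith [hle j, norm_nonneg (p j 0)]
      _ = (2 * s) ^ d := by simp
  · rw [hnorm]
    gcongr
    calc (‖v‖ / 2) ^ d = ∏ _j : Fin d, (‖v‖ / 2) := by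
            rw [Finset.prod_const, Finset.card_univ, Fintype.card_fin]
      _ ≤ ∏ j, ‖v - p j 0‖ := Finset.prod_le_prod (fun _ _ => by positivity) fun j _ => by
            have := norm_sub_norm_le v (p j 0)
            linarith [hle j]

theorem tendsto_log_log_maxModulus :
    Tendsto (fun r => Real.log (Real.log (maxModulus f r)) / Real.log r) atTop
      (𝓝 (Real.log d / Real.log ‖a‖)) := by
  obtain ⟨K, hK, c, hc, hP⟩ := S.exists_polynomial_bounds
  set A := |Real.log c| + d * Real.log 2 with hA
  have hA0 : 0 ≤ A := by positivity
  -- By Liouville `f` is unbounded. Beyond `‖z₀‖` the maximum modulus exceeds the threshold `K` and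
  -- its logarithm exceeds `A + 1`.
  obtain ⟨z₀, hz₀⟩ := S.exists_le_norm_apply (max K (Real.exp (A + 1)))
  set r₀ := ‖z₀‖ + 1 with hr₀
  have hr₀0 : 0 < r₀ := by positivity
  have hM : ∀ r, r₀ ≤ r → max K (Real.exp (A + 1)) ≤ maxModulus f r := fun r hr =>
    hz₀.trans (norm_le_maxModulus S.differentiable (hr₀0.trans_le hr) (by linarith))
  have hMK : ∀ r, r₀ ≤ r → K ≤ maxModulus f r := fun r hr => (le_max_left _ _).trans (hM r hr)
  have hMpos : ∀ r, r₀ ≤ r → 0 < maxModulus f r := fun r hr => hK.trans_le (hMK r hr)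
  have hlog : ∀ x, 0 < x → Real.log (c * x ^ d) = Real.log c + d * Real.log x := fun x hx => by
    rw [Real.log_mul hc.ne' (by positivity), Real.log_pow]
  have hN := S.norm_pos
  have hmul : ∀ r, r₀ ≤ r → r₀ ≤ ‖a‖ * r := fun r hr =>
    hr.trans (le_mul_of_one_le_left (hr₀0.le.trans hr) S.one_lt_norm.le)
  refine tendsto_log_div_log_of_rescaling (A := A) S.two_le S.one_lt_norm hr₀0 hA0 ?_ ?_ ?_ ?_
  · intro r hr s hs hrs
    exact Real.log_le_log (hMpos r hr) (maxModulus_mono S.differentiable (hr₀0.trans_le hr) hrs)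
  · intro r hr
    rw [Real.le_log_iff_exp_le (hMpos r hr)]
    exact (le_max_right _ _).trans (hM r hr)
  · intro r hr
    have hr0 : 0 < r := hr₀0.trans_le hr
    obtain ⟨z, hz, h⟩ := exists_norm_eq_maxModulus S.differentiable hr0.le
    have h1 := (hP (f z)).2 (by rw [h]; exact hMK r hr)
    rw [← S.map_mul, h] at h1
    have h2 : ‖f (a * z)‖ ≤ maxModulus f (‖a‖ * r) :=
      norm_le_maxModulus S.differentiable (by positivity) (by rw [norm_mul, hz])
    have hx : 0 < maxModulus f r / 2 := half_pos (hMpos r hr)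
    have h3 := Real.log_le_log (by positivity) (h1.trans h2)
    rw [hlog _ hx, Real.log_div (hMpos r hr).ne' two_ne_zero] at h3
    linarith [neg_abs_le (Real.log c)]
  · intro r hr
    have hr0 : 0 < r := hr₀0.trans_le hr
    obtain ⟨z, hz, h⟩ := exists_norm_eq_maxModulus S.differentiable (r := ‖a‖ * r) (by positivity)
    have h2 : ‖f (z / a)‖ ≤ maxModulus f r := norm_le_maxModulus S.differentiable hr0 (by
      rw [norm_div, hz, mul_div_cancel_left₀ _ hN.ne'])
    have h1 := (hP (f (z / a))).1 _ (hMK r hr) h2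
    rw [S.map_div, h] at h1
    have h3 := Real.log_le_log (hMpos _ (hmul r hr)) h1
    have hx : 0 < 2 * maxModulus f r := by linarith [hMpos r hr]
    rw [hlog _ hx, Real.log_mul two_ne_zero (hMpos r hr).ne'] at h3
    linarith [le_abs_self (Real.log c)]

theorem growthOrder_eq : growthOrder f = ((Real.log d / Real.log ‖a‖ : ℝ) : EReal) :=
  ((continuous_coe_real_ereal.tendsto _).comp S.tendsto_log_log_maxModulus).limsup_eq

theorem log_div_log_lt_one : Real.log d / Real.log ‖a‖ < 1 := by
  rw [div_lt_one (Real.log_pos S.one_lt_norm)]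
  have h : (2 : ℝ) ≤ d := by exact_mod_cast S.two_le
  exact Real.log_lt_log (by linarith) S.lt_norm

end IsPoincareSystem

end SchroederPoincare

theorem corollary2 (d : ℕ) [NeZero d] (hd : 2 ≤ d) (P : ℂ[X]) (hP : P.natDegree = d)
    (a b : ℂ) (hfix : P.eval b = b) (ha : a = P.derivative.eval b) (hda : (d : ℝ) < ‖a‖)
    (f : ℂ → ℂ) (hf : Differentiable ℂ f) (hfP : ∀ z, f (a * z) = P.eval (f z))
    (hf0 : f 0 = b) (hf1 : deriv f 0 = 1)
    (p : Fin d → ℂ → ℂ) (hp : SchroederPoincare.IsBranchSystem P p)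
    (hp0 : p 0 b = b) (hp0an : AnalyticAt ℂ (p 0) b)
    (hyp1 : ∀ w, Tendsto (fun n : ℕ => (p 0)^[n] w) atTop (𝓝 b)) :
    -- the order of `f`
    (SchroederPoincare.growthOrder f = ((Real.log d / Real.log ‖a‖ : ℝ) : EReal) ∧
      Real.log d / Real.log ‖a‖ < 1) ∧
    -- the factorization for `w ≠ b`
    (∀ w : ℂ, w ≠ b →
      (∀ σ : SchroederPoincare.Stable d,
        Multipliable (fun n : ℕ =>
          a / (SchroederPoincare.Q P b).eval (SchroederPoincare.orbit p σ.1 w (n + 1))) ∧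
        SchroederPoincare.g P a b p σ.1 w ≠ 0) ∧
      Summable (fun σ : SchroederPoincare.Stable d =>
        ‖(SchroederPoincare.g P a b p σ.1 w)⁻¹‖) ∧
      ∀ z : ℂ,
        Multipliable (fun σ : SchroederPoincare.Stable d =>
          1 - z / SchroederPoincare.g P a b p σ.1 w) ∧
        f z = w + (b - w) * ∏' σ : SchroederPoincare.Stable d,
          (1 - z / SchroederPoincare.g P a b p σ.1 w)) ∧
    -- the particular case `w = 0`
    (b ≠ 0 →
      (∀ σ : SchroederPoincare.Stable d,
        Multipliable (fun n : ℕ =>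
          (SchroederPoincare.Q P b).eval (SchroederPoincare.orbit p σ.1 0 (n + 1)) / a)) ∧
      ∀ z : ℂ,
        Multipliable (fun σ : SchroederPoincare.Stable d =>
          1 + z / b * ∏' n : ℕ,
            (SchroederPoincare.Q P b).eval (SchroederPoincare.orbit p σ.1 0 (n + 1)) / a) ∧
        f z = b * ∏' σ : SchroederPoincare.Stable d,
          (1 + z / b * ∏' n : ℕ,
            (SchroederPoincare.Q P b).eval (SchroederPoincare.orbit p σ.1 0 (n + 1)) / a)) ∧
    -- the factorization for `w = b`
    ((∀ σ : SchroederPoincare.StableNe d,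
        Multipliable (fun n : ℕ =>
          a / (SchroederPoincare.Q P b).eval (SchroederPoincare.orbit p σ.1.1 b (n + 2))) ∧
        SchroederPoincare.gZero P a b p σ.1.1 ≠ 0) ∧
      Summable (fun x : ℕ × SchroederPoincare.StableNe d =>
        ‖(a ^ x.1 * SchroederPoincare.gZero P a b p x.2.1.1)⁻¹‖) ∧
      ∀ z : ℂ,
        Multipliable (fun x : ℕ × SchroederPoincare.StableNe d =>
          1 - z / (a ^ x.1 * SchroederPoincare.gZero P a b p x.2.1.1)) ∧
        f z = b + z * ∏' m : ℕ, ∏' σ : SchroederPoincare.StableNe d,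
          (1 - z / (a ^ m * SchroederPoincare.gZero P a b p σ.1.1)) ∧
        f z = b + SchroederPoincare.qPochhammer
          (fun σ : SchroederPoincare.StableNe d =>
            z / SchroederPoincare.gZero P a b p σ.1.1) (1 / a) * z) ∧
    -- the momenta formulas
    (∀ w : ℂ, w ≠ b →
      (∀ m : ℕ, 1 ≤ m → ∀ σ : SchroederPoincare.Stable d, Multipliable (fun n : ℕ =>
        (SchroederPoincare.Q P b).eval (SchroederPoincare.orbit p σ.1 w (n + 1)) ^ m / a ^ m)) ∧
      HasSum (fun σ : SchroederPoincare.Stable d => ∏' n : ℕ,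
        (SchroederPoincare.Q P b).eval (SchroederPoincare.orbit p σ.1 w (n + 1)) / a) 1 ∧
      HasSum (fun σ : SchroederPoincare.Stable d => ∏' n : ℕ,
        (SchroederPoincare.Q P b).eval (SchroederPoincare.orbit p σ.1 w (n + 1)) ^ 2 / a ^ 2)
        (1 - (b - w) * P.derivative.derivative.eval b / (a ^ 2 - a)) ∧
      ∀ m : ℕ, 2 ≤ m →
        HasSum (fun σ : SchroederPoincare.Stable d => ∏' n : ℕ,
          (SchroederPoincare.Q P b).eval (SchroederPoincare.orbit p σ.1 w (n + 1)) ^ m / a ^ m)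
          (∑ j ∈ Finset.Icc 1 m, (w - b) ^ (m - j) * ((j - 1)! : ℂ) / ((m - 1)! : ℂ) *
            SchroederPoincare.bell m j (fun i => iteratedDeriv i f 0))) := by
  have S : SchroederPoincare.IsPoincareSystem P a b f p :=
    ⟨hd, hP, hfix, ha, hda, hf, hfP, hf0, hf1, hp, hp0, hp0an, hyp1⟩
  refine ⟨⟨S.growthOrder_eq, S.log_div_log_lt_one⟩, fun w hw => ⟨fun σ =>
    ⟨S.multipliable_div_Q σ w, S.g_ne_zero hw σ⟩, S.summable_norm_inv_g hw, fun z =>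
    ⟨S.multipliable_one_sub_div_g hw z, S.apply_eq_tprod hw z⟩⟩, fun hb => ⟨fun σ =>
    S.multipliable_Q_div σ 0, fun z => ?_⟩, ⟨fun σ => ⟨S.multipliable_div_Q_fixed σ,
    S.gZero_ne_zero σ⟩, S.summable_norm_inv_pow_mul_gZero, fun z =>
    ⟨S.multipliable_pow_mul_gZero z, S.apply_eq_tprod_tprod z, S.apply_eq_qPochhammer z⟩⟩,
    fun w hw => ⟨fun m _ σ => (S.hasProd_Q_pow_div hw σ m).multipliable, S.hasSum_tprod_one hw,
    S.hasSum_tprod_two hw, fun m hm => S.hasSum_tprod_bell hw (by omega)⟩⟩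
  -- At `w = 0` the product of `Q / a` is `-b / g`, so both forms of the factor agree.
  have h : ∀ σ : SchroederPoincare.Stable d, 1 + z / b * ∏' n : ℕ,
      (SchroederPoincare.Q P b).eval (SchroederPoincare.orbit p σ.1 0 (n + 1)) / a =
      1 - z / SchroederPoincare.g P a b p σ.1 0 := fun σ => by
    have h0 := S.g_ne_zero hb.symm σ
    rw [S.tprod_Q_div hb.symm]
    field_simp
    ring
  simp only [h]
  exact ⟨S.multipliable_one_sub_div_g hb.symm z, by simpa using S.apply_eq_tprod hb.symm z⟩
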